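/- For every $\varepsilon_0>0$ and $C_0>0$ there is a constant $\delta_0=\delta_0(\varepsilon_0,C_0)>0$ such that the following holds. Let $d=(d_1,d_2,d_3):\mathbb R^2\to\mathbb S^2\subset\mathbb R^3$ be a map (that is, $|d|=1$ almost everywhere) whose weak gradient satisfies $\nabla d\in H^1(\mathbb R^2)$ and $\|\nabla d\|_{L^2}\le C_0$, and suppose that $d_3\ge\varepsilon_0$ almost everywhere. Then $$\|\nabla d\|_{L^4}^4\le(1-\delta_0)\,\|\Delta d\|_{L^2}^2,$$ and, with the same $\delta_0$, the harmonic energy is coercive: $$\big\|\Delta d+|\nabla d|^2d\big\|_{L^2}^2\ge\frac{\delta_0}{2}\Big(\|\Delta d\|_{L^2}^2+\|\nabla d\|_{L^4}^4\Big).$$ Here derivatives are weak derivatives, $|\nabla d|^2=\sum_{i=1}^{2}\sum_{k=1}^{3}|\partial_i d_k|^2$, $\Delta d=\partial_1^2d+\partial_2^2d$, and $L^p$ norms are over $\mathbb R^2$ with Lebesgue measure. -/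

import Mathlib

open MeasureTheory

/-- The plane `ℝ²` with its Euclidean norm and Lebesgue measure. -/
abbrev Plane : Type := EuclideanSpace ℝ (Fin 2)

/-- The space `ℝ³` with its Euclidean norm, in which the unit sphere `S²` lies. -/
abbrev Space3 : Type := EuclideanSpace ℝ (Fin 3)

/-- Pairs `(∂₁f, ∂₂f)` of partial derivatives of an `F`-valued map, with the norm
`(‖∂₁f‖² + ‖∂₂f‖²)^(1/2)`. For `F = ℝ³` this is the usual (Frobenius) length of `∇f`. -/
abbrev GradSpace (F : Type) [NormedAddCommGroup F] [NormedSpace ℝ F] : Type :=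
  PiLp 2 (fun _ : Fin 2 => F)

/-- `g` is the `i`-th weak (distributional) partial derivative on `ℝ²` of `f`: both are locally
integrable, and `∫ (∂ᵢφ) f = - ∫ φ g` for all test functions `φ ∈ C_c^∞(ℝ²)`. -/
def HasWeakPartial {F : Type} [NormedAddCommGroup F] [NormedSpace ℝ F] [CompleteSpace F]
    (i : Fin 2) (f g : Plane → F) : Prop :=
  LocallyIntegrable f volume ∧ LocallyIntegrable g volume ∧
    ∀ φ : Plane → ℝ, ContDiff ℝ (⊤ : ℕ∞) φ → HasCompactSupport φ →
      ∫ x, (fderiv ℝ φ x (EuclideanSpace.single i 1)) • f x = - ∫ x, φ x • g x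

/-- `g = ∇f` in the weak sense on `ℝ²`. -/
def HasWeakGrad {F : Type} [NormedAddCommGroup F] [NormedSpace ℝ F] [CompleteSpace F]
    (f : Plane → F) (g : Plane → GradSpace F) : Prop :=
  ∀ i : Fin 2, HasWeakPartial i f (fun x => g x i)

/-- `f ∈ H¹(ℝ²)` with weak gradient `g`: `f ∈ L²`, `g = ∇f` weakly and `g ∈ L²`. -/
def MemH1WithGrad {F : Type} [NormedAddCommGroup F] [NormedSpace ℝ F] [CompleteSpace F]
    (f : Plane → F) (g : Plane → GradSpace F) : Prop :=
  MemLp f 2 volume ∧ HasWeakGrad f g ∧ MemLp g 2 volume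

/-- The Laplacian `∂₁∂₁f + ∂₂∂₂f`, read off from the second gradient `D2f = ∇(∇f)`, whose entry
`D2f x j i` is `∂ⱼ∂ᵢf (x)`. -/
noncomputable def laplacianOfHessian {F : Type} [NormedAddCommGroup F] [NormedSpace ℝ F]
    (D2f : Plane → GradSpace (GradSpace F)) (x : Plane) : F :=
  ∑ i : Fin 2, D2f x i i

/-- The harmonic map tension `Δd + |∇d|² d`, where `Dd = ∇d` and `D2d = ∇(∇d)`. -/
noncomputable def harmonicTension (d : Plane → Space3) (Dd : Plane → GradSpace Space3)
    (D2d : Plane → GradSpace (GradSpace Space3)) (x : Plane) : Space3 :=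
  laplacianOfHessian D2d x + ‖Dd x‖ ^ 2 • d x

/-!
Write `w = d₃`, `A = ‖∇d‖₄⁴`, `B = ‖Δd‖₂²` and `τ = Δd + |∇d|² d`. Differentiating `|d|² = 1` twice
gives `Δd · d = -|∇d|²`. Hence `|∇d|² ≤ |Δd|`, so that `A` is finite, and `τ` is the tangential part
of `Δd`, so that `‖τ‖₂² = B - A`. Both claims then amount to `A ≤ M (B - A)` with `M` depending on
`ε₀` only, and this follows from a Picone (or Barta) argument with the positive function `w`:

* Testing the equation of `w` with `|∂ᵢd|² / w` and summing gives
  `∫ ∑ |∂ⱼ∂ᵢd - (∂ⱼw / w) ∂ᵢd|² = ∫ |∇²d|² + ∫ Δw |∇d|² / w`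
  (`IsWeakSphereMap.integral_sq_hessian_sub`), where `∫ |∇²d|² = B`
  (`IsWeakSphereMap.integral_sq_hessian_eq`) and `Δw / w = τ₃ / w - |∇d|²`.
* The vectors `∂ᵢd` are tangential and `∂ⱼ∂ᵢd · d = -∂ᵢd · ∂ⱼd`, so the left side is at least
  `∫ ∑ (∂ᵢd · ∂ⱼd)² ≥ A / 2` (`IsWeakSphereMap.half_sq_le_sum_sq_sub`). Discarding this normal
  component would leave only the trivial inequality `A ≤ B + ∫ τ₃ |∇d|² / w`.
* Since `τ₃ |∇d|² / w ≤ |∇d|⁴ / 4 + |τ|² / ε₀²`, it follows that `A / 4 ≤ (1 + ε₀⁻²) (B - A)`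
  (`IsWeakSphereMap.integral_sq_sum_sq_u_le`).

The identities hold classically for the mollifications of the components of `d`. By Jensen's
inequality all integrands are dominated by multiples of the mollifications of one fixed integrable
function, whose integrals do not change, so a dominated convergence theorem with varying majorants
(`tendsto_integral_of_tendsto_majorant`) carries the identities over to `d`.
-/

open scoped Convolution Topology
open Filter

/-! ### Mollification on the plane -/

/-- The classical partial derivative `∂ᵢf` of a scalar function on the plane. -/
noncomputable def partialD (i : Fin 2) (f : Plane → ℝ) (x : Plane) : ℝ :=
  fderiv ℝ f x (EuclideanSpace.single i 1)

/-- Smooth bumps at the origin with radii `1 / (n + 1)` and `2 / (n + 1)`. The bounded ratio of the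
radii gives almost everywhere convergence of the mollifications. -/
noncomputable def shrinkingBump (n : ℕ) : ContDiffBump (0 : Plane) where
  rIn := 1 / (n + 1)
  rOut := 2 / (n + 1)
  rIn_pos := by positivity
  rIn_lt_rOut := by gcongr; norm_num

/-- The mollification of `f` at scale `1 / (n + 1)`. -/
noncomputable def mollify (n : ℕ) (f : Plane → ℝ) : Plane → ℝ :=
  (shrinkingBump n).normed volume ⋆[ContinuousLinearMap.lsmul ℝ ℝ, volume] f

theorem mollify_apply (n : ℕ) (f : Plane → ℝ) (x : Plane) :
    mollify n f x = ∫ t, (shrinkingBump n).normed volume t * f (x - t) := rfl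

theorem locallyIntegrable_comp_sub_left {f : Plane → ℝ} (hf : LocallyIntegrable f volume)
    (x : Plane) : LocallyIntegrable (fun t => f (x - t)) volume := by
  rw [locallyIntegrable_iff] at hf ⊢
  intro K hK
  have h1 : IsCompact ((fun t => x - t) '' K) := hK.image (by fun_prop)
  have h3 := ((hf _ h1).integrable_indicator h1.measurableSet).comp_sub_left x
  refine (h3.integrableOn (s := K)).congr_fun (fun t ht => ?_) hK.measurableSet
  simp only
  rw [Set.indicator_of_mem (Set.mem_image_of_mem _ ht)]

theorem integrable_kernel_mul {k f : Plane → ℝ} (hk : Continuous k) (hks : HasCompactSupport k)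
    (hf : LocallyIntegrable f volume) (x : Plane) :
    Integrable (fun t => k t * f (x - t)) volume :=
  (locallyIntegrable_comp_sub_left hf x).integrable_smul_left_of_hasCompactSupport hk hks

theorem mollify_integrable_kernel (n : ℕ) {f : Plane → ℝ} (hf : LocallyIntegrable f volume)
    (x : Plane) : Integrable (fun t => (shrinkingBump n).normed volume t * f (x - t)) volume :=
  integrable_kernel_mul (shrinkingBump n).continuous_normed
    (shrinkingBump n).hasCompactSupport_normed hf x

theorem contDiff_mollify (n : ℕ) {f : Plane → ℝ} (hf : LocallyIntegrable f volume) :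
    ContDiff ℝ (⊤ : ℕ∞) (mollify n f) :=
  (shrinkingBump n).hasCompactSupport_normed.contDiff_convolution_left _
    (shrinkingBump n).contDiff_normed hf

theorem ae_tendsto_mollify {f : Plane → ℝ} (hf : LocallyIntegrable f volume) :
    ∀ᵐ x, Tendsto (fun n => mollify n f x) atTop (𝓝 (f x)) := by
  refine ContDiffBump.ae_convolution_tendsto_right_of_locallyIntegrable (K := 2) ?_ ?_ hf
  · have := (tendsto_one_div_add_atTop_nhds_zero_nat (𝕜 := ℝ)).const_mul 2
    simpa [shrinkingBump, div_eq_mul_inv] using this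
  · exact Eventually.of_forall fun n => le_of_eq (by simp [shrinkingBump, div_eq_mul_inv])

theorem mollify_mono (n : ℕ) {f g : Plane → ℝ} (hf : LocallyIntegrable f volume)
    (hg : LocallyIntegrable g volume) (h : ∀ᵐ x, f x ≤ g x) (x : Plane) :
    mollify n f x ≤ mollify n g x := by
  refine integral_mono_ae (mollify_integrable_kernel n hf x) (mollify_integrable_kernel n hg x) ?_
  have h' : ∀ᵐ t, f (x - t) ≤ g (x - t) :=
    (quasiMeasurePreserving_sub_left volume x).ae h
  filter_upwards [h'] with t ht
  exact mul_le_mul_of_nonneg_left ht ((shrinkingBump n).nonneg_normed t)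

theorem mollify_const (n : ℕ) (c : ℝ) (x : Plane) : mollify n (fun _ => c) x = c := by
  rw [mollify_apply, integral_mul_const, (shrinkingBump n).integral_normed, one_mul]

theorem le_mollify (n : ℕ) {f : Plane → ℝ} (hf : LocallyIntegrable f volume) {c : ℝ}
    (h : ∀ᵐ x, c ≤ f x) (x : Plane) : c ≤ mollify n f x := by
  rw [← mollify_const n c x]
  exact mollify_mono n (locallyIntegrable_const c) hf h x

theorem mollify_le (n : ℕ) {f : Plane → ℝ} (hf : LocallyIntegrable f volume) {c : ℝ}
    (h : ∀ᵐ x, f x ≤ c) (x : Plane) : mollify n f x ≤ c := by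
  rw [← mollify_const n c x]
  exact mollify_mono n hf (locallyIntegrable_const c) h x

/-- Jensen's inequality (equivalently, Cauchy–Schwarz) for a nonnegative kernel. -/
theorem sq_integral_kernel_le {k f : Plane → ℝ} (hk : Continuous k) (hks : HasCompactSupport k)
    (hk0 : ∀ t, 0 ≤ k t) (hf : LocallyIntegrable f volume)
    (hf2 : LocallyIntegrable (fun x => f x ^ 2) volume) (x : Plane) :
    (∫ t, k t * f (x - t)) ^ 2 ≤ (∫ t, k t) * ∫ t, k t * f (x - t) ^ 2 := by
  have i1 := integrable_kernel_mul hk hks hf x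
  have i2 := integrable_kernel_mul hk hks hf2 x
  have i0 : Integrable k volume := hk.integrable_of_hasCompactSupport hks
  -- The quadratic polynomial `c ↦ ∫ k (c - f)²` is nonnegative, hence so is minus its discriminant.
  have key : ∀ c : ℝ, 0 ≤ (∫ t, k t) * (c * c) + (-2 * ∫ t, k t * f (x - t)) * c
      + ∫ t, k t * f (x - t) ^ 2 := by
    intro c
    have : 0 ≤ ∫ t, (k t * (c * c) + (k t * f (x - t)) * (-2 * c) + k t * f (x - t) ^ 2) := by
      refine integral_nonneg fun t => ?_
      have := mul_nonneg (hk0 t) (sq_nonneg (c - f (x - t)))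
      simp only [Pi.zero_apply]
      nlinarith
    rw [integral_add (by exact (i0.mul_const _).add (i1.mul_const _)) i2,
      integral_add (i0.mul_const _) (i1.mul_const _), integral_mul_const, integral_mul_const] at this
    linarith
  have := discrim_le_zero key
  rw [discrim] at this
  nlinarith

theorem sq_mollify_le (n : ℕ) {f : Plane → ℝ} (hf : LocallyIntegrable f volume)
    (hf2 : LocallyIntegrable (fun x => f x ^ 2) volume) (x : Plane) :
    mollify n f x ^ 2 ≤ mollify n (fun x => f x ^ 2) x := by
  have := sq_integral_kernel_le ((shrinkingBump n).continuous_normed (μ := volume))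
    (shrinkingBump n).hasCompactSupport_normed (shrinkingBump n).nonneg_normed hf hf2 x
  rwa [(shrinkingBump n).integral_normed, one_mul] at this

theorem integrable_mollify (n : ℕ) {f : Plane → ℝ} (hf : Integrable f volume) :
    Integrable (mollify n f) volume :=
  (shrinkingBump n).integrable_normed.integrable_convolution _ hf

theorem integral_mollify (n : ℕ) {f : Plane → ℝ} (hf : Integrable f volume) :
    ∫ x, mollify n f x = ∫ x, f x := by
  have := integral_convolution (ContinuousLinearMap.lsmul ℝ ℝ)
    ((shrinkingBump n).integrable_normed (μ := volume)) hf
  rw [(shrinkingBump n).integral_normed] at this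
  exact this.trans (by simp)

theorem partialD_mollify_eq_kernel (n : ℕ) {f : Plane → ℝ} (hf : LocallyIntegrable f volume)
    (i : Fin 2) (x : Plane) :
    partialD i (mollify n f) x
      = ∫ t, partialD i ((shrinkingBump n).normed volume) t * f (x - t) := by
  have h1 : ContDiff ℝ 1 ((shrinkingBump n).normed (volume : Measure Plane)) :=
    (shrinkingBump n).contDiff_normed
  have hc := (shrinkingBump n).hasCompactSupport_normed (μ := (volume : Measure Plane))
  have h2 := hc.hasFDerivAt_convolution_left (ContinuousLinearMap.lsmul ℝ ℝ) h1 hf x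
  rw [partialD, mollify, h2.fderiv, convolution_def, ContinuousLinearMap.integral_apply]
  · rfl
  · exact ((hc.fderiv ℝ).convolutionExists_left _ (h1.continuous_fderiv one_ne_zero) hf) x

/-- Mollification turns weak partial derivatives into classical ones. -/
theorem partialD_mollify (n : ℕ) {f g : Plane → ℝ} {i : Fin 2} (h : HasWeakPartial i f g) :
    partialD i (mollify n f) = mollify n g := by
  funext x
  obtain ⟨hf, hg, hφ⟩ := h
  set ρ := (shrinkingBump n).normed (volume : Measure Plane) with hρ
  have hρs : ContDiff ℝ (⊤ : ℕ∞) ρ := (shrinkingBump n).contDiff_normed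
  have hc : HasCompactSupport ρ := (shrinkingBump n).hasCompactSupport_normed
  have hd : ∀ y, fderiv ℝ (fun t => ρ (x - t)) y (EuclideanSpace.single i 1)
      = - partialD i ρ (x - y) := by
    intro y
    have h2 : HasFDerivAt ρ (fderiv ℝ ρ (x - y)) (x - y) :=
      (hρs.differentiable (by simp) _).hasFDerivAt
    have h3 := h2.comp y ((hasFDerivAt_id y).const_sub x)
    have h4 : fderiv ℝ (fun t => ρ (x - t)) y = _ := h3.fderiv
    simp [h4, partialD]
  have h1 := hφ (fun t => ρ (x - t)) (by fun_prop)
    (hc.comp_homeomorph (Homeomorph.subLeft x))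
  simp only [hd, smul_eq_mul] at h1
  rw [partialD_mollify_eq_kernel n hf, mollify_apply, ← integral_sub_left_eq_self _ volume x,
    ← integral_sub_left_eq_self (fun t => (shrinkingBump n).normed volume t * g (x - t)) volume x]
  simp only [sub_sub_cancel, ← hρ]
  simp only [neg_mul, integral_neg, neg_inj] at h1
  exact h1

theorem integrable_sq_partialD_mollify (n : ℕ) {f : Plane → ℝ} (hf : LocallyIntegrable f volume)
    (hf2 : Integrable (fun x => f x ^ 2) volume) (i : Fin 2) :
    Integrable (fun x => partialD i (mollify n f) x ^ 2) volume := by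
  set ρ := (shrinkingBump n).normed (volume : Measure Plane) with hρ
  have hρs : ContDiff ℝ (⊤ : ℕ∞) ρ := (shrinkingBump n).contDiff_normed
  have hc : HasCompactSupport ρ := (shrinkingBump n).hasCompactSupport_normed
  have hk : Continuous (partialD i ρ) :=
    (hρs.continuous_fderiv (by simp)).clm_apply continuous_const
  have hks : HasCompactSupport (partialD i ρ) := hc.fderiv_apply ℝ _
  have hm : Continuous (partialD i (mollify n f)) :=
    ((contDiff_mollify n hf).continuous_fderiv (by simp)).clm_apply continuous_const
  have hI : Integrable (fun x => ∫ t, |partialD i ρ t| * f (x - t) ^ 2) volume :=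
    (hk.abs.integrable_of_hasCompactSupport hks.abs).integrable_convolution
      (ContinuousLinearMap.lsmul ℝ ℝ) hf2
  refine (hI.const_mul (∫ t, |partialD i ρ t|)).mono' (by fun_prop) (ae_of_all _ fun x => ?_)
  rw [partialD_mollify_eq_kernel n hf, Real.norm_of_nonneg (sq_nonneg _)]
  have h1 := sq_integral_kernel_le hk.abs hks.abs (fun t => abs_nonneg _)
    (fun y => let ⟨s, hs, hi⟩ := hf y; ⟨s, hs, hi.norm⟩ : LocallyIntegrable (fun y => ‖f y‖) volume)
    (by simpa using hf2.locallyIntegrable) x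
  simp only [Real.norm_eq_abs, sq_abs] at h1
  refine le_trans (sq_le_sq.mpr ?_) h1
  refine (abs_integral_le_integral_abs).trans (le_trans (le_of_eq ?_) (le_abs_self _))
  simp [abs_mul, hρ]

/-! ### Passage to the limit -/

/-- Dominated convergence with a convergent sequence of majorants in place of a fixed one. -/
theorem tendsto_integral_of_tendsto_majorant {α : Type*} [MeasurableSpace α] {μ : Measure α}
    {F G : ℕ → α → ℝ} {f g : α → ℝ} (hF : ∀ n, AEStronglyMeasurable (F n) μ)
    (hG : ∀ n, Integrable (G n) μ) (hg : Integrable g μ) (hle : ∀ n x, |F n x| ≤ G n x)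
    (hGg : ∀ᵐ x ∂μ, Tendsto (fun n => G n x) atTop (𝓝 (g x)))
    (hFf : ∀ᵐ x ∂μ, Tendsto (fun n => F n x) atTop (𝓝 (f x)))
    (hint : Tendsto (fun n => ∫ x, G n x ∂μ) atTop (𝓝 (∫ x, g x ∂μ))) :
    Tendsto (fun n => ∫ x, F n x ∂μ) atTop (𝓝 (∫ x, f x ∂μ)) := by
  have hg0 : ∀ᵐ x ∂μ, 0 ≤ g x := by
    filter_upwards [hGg] with x hx
    exact ge_of_tendsto' hx fun n => (abs_nonneg _).trans (hle n x)
  have hmin : Tendsto (fun n => ∫ x, min (G n x) (g x) ∂μ) atTop (𝓝 (∫ x, g x ∂μ)) := by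
    refine tendsto_integral_of_dominated_convergence g
      (fun n => ((hG n).inf hg).aestronglyMeasurable) hg (fun n => ?_) ?_
    · filter_upwards [hg0] with x hx
      rw [Real.norm_of_nonneg (le_min ((abs_nonneg _).trans (hle n x)) hx)]
      exact min_le_right _ _
    · filter_upwards [hGg] with x hx
      simpa using hx.min (tendsto_const_nhds (x := g x))
  -- The truncation of `F n` at height `g` has the fixed majorant `g`, and the remainder is at most
  -- `G n - min (G n) g`, whose integral tends to `0`.
  have hclampm : ∀ n, AEStronglyMeasurable (fun x => max (-g x) (min (g x) (F n x))) μ :=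
    fun n => hg.aestronglyMeasurable.neg.sup (hg.aestronglyMeasurable.inf (hF n))
  have hclamp : ∀ n, ∀ᵐ x ∂μ, ‖max (-g x) (min (g x) (F n x))‖ ≤ g x := fun n => by
    filter_upwards [hg0] with x hx
    rw [Real.norm_eq_abs, abs_le]
    exact ⟨le_max_left _ _, max_le (by linarith) (min_le_left _ _)⟩
  have h1 : Tendsto (fun n => ∫ x, max (-g x) (min (g x) (F n x)) ∂μ) atTop
      (𝓝 (∫ x, f x ∂μ)) := by
    refine tendsto_integral_of_dominated_convergence g hclampm hg hclamp ?_
    filter_upwards [hGg, hFf] with x hx hx'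
    have hfg : |f x| ≤ g x := le_of_tendsto_of_tendsto' hx'.abs hx fun n => hle n x
    have h2 := (tendsto_const_nhds (x := -g x)).max ((tendsto_const_nhds (x := g x)).min hx')
    rwa [min_eq_right (abs_le.mp hfg).2, max_eq_right (abs_le.mp hfg).1] at h2
  have hFi : ∀ n, Integrable (F n) μ := fun n =>
    (hG n).mono' (hF n) (ae_of_all _ fun x => hle n x)
  have hci : ∀ n, Integrable (fun x => max (-g x) (min (g x) (F n x))) μ := fun n =>
    hg.mono' (hclampm n) (hclamp n)
  have h2 : Tendsto (fun n => ∫ x, (F n x - max (-g x) (min (g x) (F n x))) ∂μ) atTop (𝓝 0) := by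
    have h3 := hint.sub hmin
    rw [sub_self] at h3
    refine squeeze_zero_norm (fun n => ?_) h3
    rw [← integral_sub (hG n) (by exact (hG n).inf hg)]
    refine norm_integral_le_of_norm_le ((hG n).sub ((hG n).inf hg)) ?_
    filter_upwards [hg0] with x hx
    have := abs_le.mp (hle n x)
    rw [Real.norm_eq_abs, abs_le]
    grind
  have h3 := h2.add h1
  rw [zero_add] at h3
  refine h3.congr fun n => ?_
  rw [integral_sub (hFi n) (hci n)]
  ring

theorem integrable_of_le_mollify {S a F : Plane → ℝ} (hS : Integrable S volume)
    (ha : Integrable a volume) {C : ℝ} {n : ℕ} (hF : Continuous F)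
    (hle : ∀ x, |F x| ≤ a x + C * mollify n S x) : Integrable F volume :=
  (ha.add ((integrable_mollify n hS).const_mul C)).mono' hF.aestronglyMeasurable
    (ae_of_all _ hle)

theorem integrable_of_tendsto_of_le_mollify {S a f : Plane → ℝ} (hS : Integrable S volume)
    (ha : Integrable a volume) {C : ℝ} {F : ℕ → Plane → ℝ} (hF : ∀ n, Continuous (F n))
    (hle : ∀ n x, |F n x| ≤ a x + C * mollify n S x)
    (hlim : ∀ᵐ x, Tendsto (fun n => F n x) atTop (𝓝 (f x))) : Integrable f volume := by
  refine (ha.add (hS.const_mul C)).mono' (aestronglyMeasurable_of_tendsto_ae atTop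
    (fun n => (hF n).aestronglyMeasurable) hlim) ?_
  filter_upwards [hlim, ae_tendsto_mollify hS.locallyIntegrable] with x h1 h2
  exact le_of_tendsto_of_tendsto' h1.abs ((h2.const_mul C).const_add (a x)) fun n => hle n x

/-- Passage to the limit under the integral for functions controlled by the mollifications of one
integrable function `S`. -/
theorem tendsto_integral_of_le_mollify {S a f : Plane → ℝ} (hS : Integrable S volume)
    (ha : Integrable a volume) {C : ℝ} {F : ℕ → Plane → ℝ} (hF : ∀ n, Continuous (F n))
    (hle : ∀ n x, |F n x| ≤ a x + C * mollify n S x)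
    (hlim : ∀ᵐ x, Tendsto (fun n => F n x) atTop (𝓝 (f x))) :
    Tendsto (fun n => ∫ x, F n x) atTop (𝓝 (∫ x, f x)) := by
  refine tendsto_integral_of_tendsto_majorant (fun n => (hF n).aestronglyMeasurable)
    (fun n => ha.add ((integrable_mollify n hS).const_mul C)) (ha.add (hS.const_mul C))
    hle ?_ hlim ?_
  · filter_upwards [ae_tendsto_mollify hS.locallyIntegrable] with x hx
    exact (hx.const_mul C).const_add (a x)
  · refine tendsto_const_nhds.congr fun n => ?_
    simp only [Pi.add_apply]
    rw [integral_add ha (hS.const_mul C), integral_add ha ((integrable_mollify n hS).const_mul C),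
      integral_const_mul, integral_const_mul, integral_mollify n hS]

/-! ### Classical partial derivatives -/

theorem partialD_mul {f g : Plane → ℝ} {x : Plane} (hf : DifferentiableAt ℝ f x)
    (hg : DifferentiableAt ℝ g x) (i : Fin 2) :
    partialD i (fun y => f y * g y) x = partialD i f x * g x + f x * partialD i g x := by
  simp only [partialD]
  rw [fderiv_fun_mul hf hg]
  simp only [add_apply, smul_apply, smul_eq_mul]
  ring

theorem partialD_sum {ι : Type*} {s : Finset ι} {f : ι → Plane → ℝ} {x : Plane}
    (hf : ∀ k ∈ s, DifferentiableAt ℝ (f k) x) (i : Fin 2) :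
    partialD i (fun y => ∑ k ∈ s, f k y) x = ∑ k ∈ s, partialD i (f k) x := by
  simp only [partialD]
  rw [fderiv_fun_sum hf]
  simp

theorem continuous_partialD {f : Plane → ℝ} (hf : ContDiff ℝ 1 f) (i : Fin 2) :
    Continuous (partialD i f) :=
  (hf.continuous_fderiv one_ne_zero).clm_apply continuous_const

theorem contDiff_partialD {f : Plane → ℝ} (hf : ContDiff ℝ (⊤ : ℕ∞) f) (i : Fin 2) :
    ContDiff ℝ (⊤ : ℕ∞) (partialD i f) :=
  (hf.fderiv_right (m := (⊤ : ℕ∞)) (by simp)).clm_apply contDiff_const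

theorem partialD_comm {f : Plane → ℝ} (hf : ContDiff ℝ (⊤ : ℕ∞) f) (i j : Fin 2) :
    partialD i (partialD j f) = partialD j (partialD i f) := by
  funext x
  have h1 : DifferentiableAt ℝ (fderiv ℝ f) x :=
    (hf.fderiv_right (m := (⊤ : ℕ∞)) (by simp)).differentiable (by simp) x
  have h2 : ∀ a b : Fin 2, partialD a (partialD b f) x
      = fderiv ℝ (fderiv ℝ f) x (EuclideanSpace.single a 1) (EuclideanSpace.single b 1) := by
    intro a b
    have h3 : fderiv ℝ (partialD b f) x = _ :=
      (h1.hasFDerivAt.clm_apply (hasFDerivAt_const (EuclideanSpace.single b 1) x)).fderiv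
    rw [partialD, h3]
    simp
  have h4 : IsSymmSndFDerivAt ℝ f x := hf.contDiffAt.isSymmSndFDerivAt (by
    rw [minSmoothness_of_isRCLikeNormedField]
    exact WithTop.coe_le_coe.2 (le_top : (2 : ℕ∞) ≤ ⊤))
  rw [h2, h2, h4.eq]

theorem integral_mul_partialD {f g : Plane → ℝ} {i : Fin 2} (hf : Differentiable ℝ f)
    (hg : Differentiable ℝ g) (h1 : Integrable (fun x => partialD i f x * g x) volume)
    (h2 : Integrable (fun x => f x * partialD i g x) volume)
    (h3 : Integrable (fun x => f x * g x) volume) :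
    ∫ x, f x * partialD i g x = - ∫ x, partialD i f x * g x :=
  integral_mul_fderiv_eq_neg_fderiv_mul_of_integrable h1 h2 h3 (fun x _ => hf x) fun x _ => hg x

/-- If smooth functions converge to a constant while their `i`-th derivatives converge to `χ`, with
bounds that allow passage to the limit in the weak formulation, then `χ = 0`. -/
theorem ae_eq_zero_of_tendsto_const {ψ : ℕ → Plane → ℝ} {χ S : Plane → ℝ} {i : Fin 2} {c C : ℝ}
    (hψ : ∀ n, ContDiff ℝ 1 (ψ n)) (hS : Integrable S volume) (hS0 : ∀ n x, 0 ≤ mollify n S x)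
    (hC : 0 ≤ C)
    (b1 : ∀ n x, |ψ n x| ≤ C + C * mollify n S x)
    (b2 : ∀ n x, |partialD i (ψ n) x| ≤ C + C * mollify n S x)
    (l1 : ∀ᵐ x, Tendsto (fun n => ψ n x) atTop (𝓝 c))
    (l2 : ∀ᵐ x, Tendsto (fun n => partialD i (ψ n) x) atTop (𝓝 (χ x))) :
    ∀ᵐ x, χ x = 0 := by
  have hmeas : AEStronglyMeasurable χ volume := aestronglyMeasurable_of_tendsto_ae atTop
    (fun n => (continuous_partialD (hψ n) i).aestronglyMeasurable) l2
  have hχ : LocallyIntegrable χ volume := by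
    have h1 : LocallyIntegrable (fun x => C + C * S x) volume :=
      (locallyIntegrable_const C).add (hS.const_mul C).locallyIntegrable
    refine h1.mono hmeas ?_
    filter_upwards [l2, ae_tendsto_mollify hS.locallyIntegrable] with x h1 h2
    have h3 : |χ x| ≤ C + C * S x :=
      le_of_tendsto_of_tendsto' h1.abs ((h2.const_mul C).const_add C) fun n => b2 n x
    exact h3.trans (le_abs_self _)
  refine ae_eq_zero_of_integral_contDiff_smul_eq_zero hχ fun φ hφ hφc => ?_
  have hφ1 : ContDiff ℝ 1 φ := hφ.of_le (by simp)
  have hd := continuous_partialD hφ1 i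
  have hdc : HasCompactSupport (partialD i φ) := hφc.fderiv_apply ℝ _
  -- A test function times a function bounded by `C + C * mollify n S` has an admissible majorant.
  have bound : ∀ θ : Plane → ℝ, Continuous θ → HasCompactSupport θ →
      ∃ a : Plane → ℝ, Integrable a volume ∧ ∃ C' : ℝ, ∀ (n : ℕ) (x : Plane) (y : ℝ),
        |y| ≤ C + C * mollify n S x → |θ x * y| ≤ a x + C' * mollify n S x := by
    intro θ hθ hθc
    obtain ⟨M, hM⟩ := hθ.bounded_above_of_compact_support hθc
    refine ⟨fun x => |θ x| * C, (hθ.abs.integrable_of_hasCompactSupport hθc.norm).mul_const C,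
      M * C, fun n x y hy => ?_⟩
    rw [abs_mul, mul_assoc]
    have h1 := mul_le_mul_of_nonneg_left hy (abs_nonneg (θ x))
    have h2 := mul_le_mul_of_nonneg_right (hM x) (mul_nonneg hC (hS0 n x))
    rw [Real.norm_eq_abs] at h2
    linarith
  obtain ⟨a₁, ha₁, C₁, hb₁⟩ := bound φ hφ.continuous hφc
  obtain ⟨a₂, ha₂, C₂, hb₂⟩ := bound _ hd hdc
  have t1 : Tendsto (fun n => ∫ x, φ x * partialD i (ψ n) x) atTop (𝓝 (∫ x, φ x * χ x)) := by
    refine tendsto_integral_of_le_mollify hS ha₁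
      (fun n => hφ.continuous.mul (continuous_partialD (hψ n) i))
      (fun n x => hb₁ n x _ (b2 n x)) ?_
    filter_upwards [l2] with x hx using hx.const_mul _
  have t2 : Tendsto (fun n => ∫ x, partialD i φ x * ψ n x) atTop
      (𝓝 (∫ x, partialD i φ x * c)) := by
    refine tendsto_integral_of_le_mollify hS ha₂ (fun n => hd.mul (hψ n).continuous)
      (fun n x => hb₂ n x _ (b1 n x)) ?_
    filter_upwards [l1] with x hx using hx.const_mul _
  have parts : ∀ g : Plane → ℝ, ContDiff ℝ 1 g →
      ∫ x, φ x * partialD i g x = - ∫ x, partialD i φ x * g x := fun g hg =>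
    integral_mul_partialD (hφ1.differentiable one_ne_zero) (hg.differentiable one_ne_zero)
      ((hd.mul hg.continuous).integrable_of_hasCompactSupport hdc.mul_right)
      ((hφ.continuous.mul (continuous_partialD hg i)).integrable_of_hasCompactSupport
        hφc.mul_right)
      ((hφ.continuous.mul hg.continuous).integrable_of_hasCompactSupport hφc.mul_right)
  have h0 : ∫ x, partialD i φ x * c = 0 := by
    have := parts (fun _ => c) contDiff_const
    simpa [partialD] using this.symm
  rw [h0] at t2
  have h1 := tendsto_nhds_unique t1 ((t2.neg).congr fun n => (parts _ (hψ n)).symm)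
  simpa using h1

/-! ### Weakly differentiable maps into the sphere -/

/-- Scalar form of the assumptions: `d` is a sphere-valued map with components `d k`, whose weak
derivatives `u i k = ∂ᵢ dₖ` and `h j i k = ∂ⱼ ∂ᵢ dₖ` are square integrable. -/
structure IsWeakSphereMap (d : Fin 3 → Plane → ℝ) (u : Fin 2 → Fin 3 → Plane → ℝ)
    (h : Fin 2 → Fin 2 → Fin 3 → Plane → ℝ) : Prop where
  weak_u : ∀ i k, HasWeakPartial i (d k) (u i k)
  weak_h : ∀ j i k, HasWeakPartial j (u i k) (h j i k)
  sq_u : ∀ i k, Integrable (fun x => u i k x ^ 2) volume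
  sq_h : ∀ j i k, Integrable (fun x => h j i k x ^ 2) volume
  sphere : ∀ᵐ x, ∑ k, d k x ^ 2 = 1

/-- If `f ^ 2 ≤ S`, the same holds after mollification. -/
theorem sq_mollify_le_of_sq_le {f S : Plane → ℝ} (hf : LocallyIntegrable f volume)
    (hf2 : Integrable (fun x => f x ^ 2) volume) (hS : Integrable S volume)
    (h : ∀ᵐ x, f x ^ 2 ≤ S x) (n : ℕ) (x : Plane) : mollify n f x ^ 2 ≤ mollify n S x :=
  (sq_mollify_le n hf hf2.locallyIntegrable x).trans
    (mollify_mono n hf2.locallyIntegrable hS.locallyIntegrable h x)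

theorem pow_four_mollify_le_of_pow_four_le {f S : Plane → ℝ} (hf : LocallyIntegrable f volume)
    (hf2 : Integrable (fun x => f x ^ 2) volume) (hf4 : Integrable (fun x => f x ^ 4) volume)
    (hS : Integrable S volume) (h : ∀ᵐ x, f x ^ 4 ≤ S x) (n : ℕ) (x : Plane) :
    mollify n f x ^ 4 ≤ mollify n S x := by
  have e : ∀ y, (f y ^ 2) ^ 2 = f y ^ 4 := fun y => by ring
  have h1 := sq_mollify_le n hf hf2.locallyIntegrable x
  have h2 := sq_mollify_le_of_sq_le (f := fun x => f x ^ 2) hf2.locallyIntegrable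
    (by simpa only [e] using hf4) hS (by simpa only [e] using h) n x
  nlinarith [sq_nonneg (mollify n f x)]

namespace IsWeakSphereMap

variable {d : Fin 3 → Plane → ℝ} {u : Fin 2 → Fin 3 → Plane → ℝ}
  {h : Fin 2 → Fin 2 → Fin 3 → Plane → ℝ}

theorem loc_d (H : IsWeakSphereMap d u h) (k : Fin 3) : LocallyIntegrable (d k) volume :=
  (H.weak_u 0 k).1

theorem loc_u (H : IsWeakSphereMap d u h) (i : Fin 2) (k : Fin 3) :
    LocallyIntegrable (u i k) volume :=
  (H.weak_u i k).2.1

theorem loc_h (H : IsWeakSphereMap d u h) (j i : Fin 2) (k : Fin 3) :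
    LocallyIntegrable (h j i k) volume :=
  (H.weak_h j i k).2.1

theorem contDiff_d (H : IsWeakSphereMap d u h) (n : ℕ) (k : Fin 3) :
    ContDiff ℝ (⊤ : ℕ∞) (mollify n (d k)) :=
  contDiff_mollify n (H.loc_d k)

theorem contDiff_u (H : IsWeakSphereMap d u h) (n : ℕ) (i : Fin 2) (k : Fin 3) :
    ContDiff ℝ (⊤ : ℕ∞) (mollify n (u i k)) :=
  contDiff_mollify n (H.loc_u i k)

theorem contDiff_h (H : IsWeakSphereMap d u h) (n : ℕ) (j i : Fin 2) (k : Fin 3) :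
    ContDiff ℝ (⊤ : ℕ∞) (mollify n (h j i k)) :=
  contDiff_mollify n (H.loc_h j i k)

theorem partialD_mollify_d (H : IsWeakSphereMap d u h) (n : ℕ) (i : Fin 2) (k : Fin 3) :
    partialD i (mollify n (d k)) = mollify n (u i k) :=
  partialD_mollify n (H.weak_u i k)

theorem partialD_mollify_u (H : IsWeakSphereMap d u h) (n : ℕ) (j i : Fin 2) (k : Fin 3) :
    partialD j (mollify n (u i k)) = mollify n (h j i k) :=
  partialD_mollify n (H.weak_h j i k)

theorem abs_mollify_d_le (H : IsWeakSphereMap d u h) (n : ℕ) (k : Fin 3) (x : Plane) :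
    |mollify n (d k) x| ≤ 1 := by
  have h1 : ∀ᵐ x, |d k x| ≤ 1 := by
    filter_upwards [H.sphere] with x hx
    rw [← sq_le_one_iff_abs_le_one, ← hx]
    exact Finset.single_le_sum (f := fun k => d k x ^ 2) (fun k _ => sq_nonneg _)
      (Finset.mem_univ k)
  rw [abs_le]
  exact ⟨le_mollify n (H.loc_d k) (by filter_upwards [h1] with x hx using (abs_le.mp hx).1) x,
    mollify_le n (H.loc_d k) (by filter_upwards [h1] with x hx using (abs_le.mp hx).2) x⟩

/-- The sum of the squares of all first and second derivatives. -/
noncomputable def energySum (u : Fin 2 → Fin 3 → Plane → ℝ)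
    (h : Fin 2 → Fin 2 → Fin 3 → Plane → ℝ) (x : Plane) : ℝ :=
  ∑ i, ∑ k, u i k x ^ 2 + ∑ j, ∑ i, ∑ k, h j i k x ^ 2

theorem integrable_energySum (H : IsWeakSphereMap d u h) : Integrable (energySum u h) volume := by
  refine Integrable.add ?_ ?_
  · exact integrable_finsetSum _ fun i _ => integrable_finsetSum _ fun k _ => H.sq_u i k
  · exact integrable_finsetSum _ fun j _ => integrable_finsetSum _ fun i _ =>
      integrable_finsetSum _ fun k _ => H.sq_h j i k

theorem sq_u_le_energySum (i : Fin 2) (k : Fin 3) (x : Plane) :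
    u i k x ^ 2 ≤ energySum u h x := by
  have h1 : u i k x ^ 2 ≤ ∑ k, u i k x ^ 2 :=
    Finset.single_le_sum (f := fun k => u i k x ^ 2) (fun k _ => sq_nonneg _) (Finset.mem_univ k)
  have h2 : ∑ k, u i k x ^ 2 ≤ ∑ i, ∑ k, u i k x ^ 2 :=
    Finset.single_le_sum (f := fun i => ∑ k, u i k x ^ 2)
      (fun i _ => Finset.sum_nonneg fun k _ => sq_nonneg _) (Finset.mem_univ i)
  have h3 : 0 ≤ ∑ j, ∑ i, ∑ k, h j i k x ^ 2 := by positivity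
  rw [energySum]
  linarith

theorem sq_h_le_energySum (j i : Fin 2) (k : Fin 3) (x : Plane) :
    h j i k x ^ 2 ≤ energySum u h x := by
  have h1 : h j i k x ^ 2 ≤ ∑ k, h j i k x ^ 2 :=
    Finset.single_le_sum (f := fun k => h j i k x ^ 2) (fun k _ => sq_nonneg _)
      (Finset.mem_univ k)
  have h2 : ∑ k, h j i k x ^ 2 ≤ ∑ i, ∑ k, h j i k x ^ 2 :=
    Finset.single_le_sum (f := fun i => ∑ k, h j i k x ^ 2)
      (fun i _ => Finset.sum_nonneg fun k _ => sq_nonneg _) (Finset.mem_univ i)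
  have h3 : ∑ i, ∑ k, h j i k x ^ 2 ≤ ∑ j, ∑ i, ∑ k, h j i k x ^ 2 :=
    Finset.single_le_sum (f := fun j => ∑ i, ∑ k, h j i k x ^ 2)
      (fun i _ => Finset.sum_nonneg fun k _ => Finset.sum_nonneg fun k _ => sq_nonneg _)
      (Finset.mem_univ j)
  have h4 : 0 ≤ ∑ i, ∑ k, u i k x ^ 2 := by positivity
  rw [energySum]
  linarith

theorem sq_mollify_u_le (H : IsWeakSphereMap d u h) (n : ℕ) (i : Fin 2) (k : Fin 3) (x : Plane) :
    mollify n (u i k) x ^ 2 ≤ mollify n (energySum u h) x :=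
  sq_mollify_le_of_sq_le (H.loc_u i k) (H.sq_u i k) H.integrable_energySum
    (ae_of_all _ fun x => sq_u_le_energySum i k x) n x

theorem sq_mollify_h_le (H : IsWeakSphereMap d u h) (n : ℕ) (j i : Fin 2) (k : Fin 3)
    (x : Plane) : mollify n (h j i k) x ^ 2 ≤ mollify n (energySum u h) x :=
  sq_mollify_le_of_sq_le (H.loc_h j i k) (H.sq_h j i k) H.integrable_energySum
    (ae_of_all _ fun x => sq_h_le_energySum j i k x) n x

theorem mollify_energySum_nonneg (H : IsWeakSphereMap d u h) (n : ℕ) (x : Plane) :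
    0 ≤ mollify n (energySum u h) x :=
  (sq_nonneg _).trans (H.sq_mollify_u_le n 0 0 x)

theorem ae_tendsto_all (H : IsWeakSphereMap d u h) : ∀ᵐ x,
    (∀ k, Tendsto (fun n => mollify n (d k) x) atTop (𝓝 (d k x))) ∧
    (∀ i k, Tendsto (fun n => mollify n (u i k) x) atTop (𝓝 (u i k x))) ∧
    ∀ j i k, Tendsto (fun n => mollify n (h j i k) x) atTop (𝓝 (h j i k x)) := by
  have h1 : ∀ᵐ x, ∀ k, Tendsto (fun n => mollify n (d k) x) atTop (𝓝 (d k x)) :=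
    ae_all_iff.2 fun k => ae_tendsto_mollify (H.loc_d k)
  have h2 : ∀ᵐ x, ∀ i k, Tendsto (fun n => mollify n (u i k) x) atTop (𝓝 (u i k x)) :=
    ae_all_iff.2 fun i => ae_all_iff.2 fun k => ae_tendsto_mollify (H.loc_u i k)
  have h3 : ∀ᵐ x, ∀ j i k, Tendsto (fun n => mollify n (h j i k) x) atTop (𝓝 (h j i k x)) :=
    ae_all_iff.2 fun j => ae_all_iff.2 fun i => ae_all_iff.2 fun k =>
      ae_tendsto_mollify (H.loc_h j i k)
  filter_upwards [h1, h2, h3] with x a b c using ⟨a, b, c⟩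

/-- Differentiating `|d|² = 1` once. -/
theorem sum_d_mul_u (H : IsWeakSphereMap d u h) (i : Fin 2) : ∀ᵐ x, ∑ k, d k x * u i k x = 0 := by
  have hd : ∀ n x, partialD i (fun y => ∑ k, mollify n (d k) y * mollify n (d k) y) x
      = 2 * ∑ k, mollify n (d k) x * mollify n (u i k) x := by
    intro n x
    have hk : ∀ k, DifferentiableAt ℝ (mollify n (d k)) x := fun k =>
      (H.contDiff_d n k).differentiable (by simp) x
    rw [partialD_sum (fun k _ => (hk k).fun_mul (hk k)), Finset.mul_sum]
    refine Finset.sum_congr rfl fun k _ => ?_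
    rw [partialD_mul (hk k) (hk k), H.partialD_mollify_d]
    ring
  have key := ae_eq_zero_of_tendsto_const
    (ψ := fun n y => ∑ k, mollify n (d k) y * mollify n (d k) y)
    (χ := fun x => 2 * ∑ k, d k x * u i k x) (i := i) (c := 1) (C := 6)
    (fun n => ContDiff.sum fun k _ => ((H.contDiff_d n k).mul (H.contDiff_d n k)).of_le (by simp))
    H.integrable_energySum H.mollify_energySum_nonneg (by norm_num) ?_ ?_ ?_ ?_
  · filter_upwards [key] with x hx
    linarith
  · intro n x
    have h0 := H.mollify_energySum_nonneg n x
    refine (Finset.abs_sum_le_sum_abs _ _).trans ((Finset.sum_le_card_nsmul _ _ 1 fun k _ => ?_).trans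
      ?_)
    · rw [abs_mul]
      exact mul_le_one₀ (H.abs_mollify_d_le n k x) (abs_nonneg _) (H.abs_mollify_d_le n k x)
    · simp
      linarith
  · intro n x
    have h0 := H.mollify_energySum_nonneg n x
    rw [hd, abs_mul, abs_two]
    have h1 : |∑ k, mollify n (d k) x * mollify n (u i k) x|
        ≤ 3 • (1 + mollify n (energySum u h) x) := by
      refine (Finset.abs_sum_le_sum_abs _ _).trans (Finset.sum_le_card_nsmul _ _ _ fun k _ => ?_)
      rw [abs_mul]
      have h2 := H.sq_mollify_u_le n i k x
      have h3 := mul_le_mul_of_nonneg_right (H.abs_mollify_d_le n k x)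
        (abs_nonneg (mollify n (u i k) x))
      nlinarith [sq_nonneg (|mollify n (u i k) x| - 1), sq_abs (mollify n (u i k) x)]
    rw [nsmul_eq_mul] at h1
    push_cast at h1
    linarith
  · filter_upwards [H.ae_tendsto_all, H.sphere] with x hx hs
    rw [← hs]
    simp only [pow_two]
    exact tendsto_finsetSum _ fun k _ => (hx.1 k).mul (hx.1 k)
  · filter_upwards [H.ae_tendsto_all] with x hx
    simp only [hd]
    exact (tendsto_finsetSum _ fun k _ => (hx.1 k).mul (hx.2.1 i k)).const_mul 2

/-- Differentiating `|d|² = 1` twice. -/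
theorem sum_d_mul_h (H : IsWeakSphereMap d u h) (j i : Fin 2) :
    ∀ᵐ x, ∑ k, d k x * h j i k x = - ∑ k, u j k x * u i k x := by
  have hd : ∀ n x, partialD j (fun y => ∑ k, mollify n (d k) y * mollify n (u i k) y) x
      = ∑ k, (mollify n (u j k) x * mollify n (u i k) x
        + mollify n (d k) x * mollify n (h j i k) x) := by
    intro n x
    have hk : ∀ k, DifferentiableAt ℝ (mollify n (d k)) x := fun k =>
      (H.contDiff_d n k).differentiable (by simp) x
    have hk' : ∀ k, DifferentiableAt ℝ (mollify n (u i k)) x := fun k =>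
      (H.contDiff_u n i k).differentiable (by simp) x
    rw [partialD_sum (fun k _ => (hk k).fun_mul (hk' k))]
    refine Finset.sum_congr rfl fun k _ => ?_
    rw [partialD_mul (hk k) (hk' k), H.partialD_mollify_d, H.partialD_mollify_u]
  have key := ae_eq_zero_of_tendsto_const
    (ψ := fun n y => ∑ k, mollify n (d k) y * mollify n (u i k) y)
    (χ := fun x => ∑ k, (u j k x * u i k x + d k x * h j i k x)) (i := j) (c := 0) (C := 6)
    (fun n => ContDiff.sum fun k _ => ((H.contDiff_d n k).mul (H.contDiff_u n i k)).of_le (by simp))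
    H.integrable_energySum H.mollify_energySum_nonneg (by norm_num) ?_ ?_ ?_ ?_
  · filter_upwards [key] with x hx
    rw [Finset.sum_add_distrib] at hx
    linarith
  · intro n x
    have h0 := H.mollify_energySum_nonneg n x
    have h1 : |∑ k, mollify n (d k) x * mollify n (u i k) x|
        ≤ 3 • (1 + mollify n (energySum u h) x) := by
      refine (Finset.abs_sum_le_sum_abs _ _).trans (Finset.sum_le_card_nsmul _ _ _ fun k _ => ?_)
      rw [abs_mul]
      have h2 := H.sq_mollify_u_le n i k x
      have h3 := mul_le_mul_of_nonneg_right (H.abs_mollify_d_le n k x)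
        (abs_nonneg (mollify n (u i k) x))
      nlinarith [sq_nonneg (|mollify n (u i k) x| - 1), sq_abs (mollify n (u i k) x)]
    rw [nsmul_eq_mul] at h1
    push_cast at h1
    linarith
  · intro n x
    have h0 := H.mollify_energySum_nonneg n x
    rw [hd]
    have h1 : |∑ k, (mollify n (u j k) x * mollify n (u i k) x
        + mollify n (d k) x * mollify n (h j i k) x)|
        ≤ 3 • (1 + 2 * mollify n (energySum u h) x) := by
      refine (Finset.abs_sum_le_sum_abs _ _).trans (Finset.sum_le_card_nsmul _ _ _ fun k _ => ?_)
      refine (abs_add_le _ _).trans ?_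
      rw [abs_mul, abs_mul]
      have h2 := H.sq_mollify_h_le n j i k x
      have h3 := mul_le_mul_of_nonneg_right (H.abs_mollify_d_le n k x)
        (abs_nonneg (mollify n (h j i k) x))
      have h4 := H.sq_mollify_u_le n i k x
      have h5 := H.sq_mollify_u_le n j k x
      nlinarith [sq_nonneg (|mollify n (h j i k) x| - 1), sq_abs (mollify n (h j i k) x),
        sq_abs (mollify n (u i k) x), sq_abs (mollify n (u j k) x),
        sq_nonneg (|mollify n (u i k) x| - |mollify n (u j k) x|)]
    rw [nsmul_eq_mul] at h1
    push_cast at h1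
    linarith
  · filter_upwards [H.ae_tendsto_all, H.sum_d_mul_u i] with x hx hs
    rw [← hs]
    exact tendsto_finsetSum _ fun k _ => (hx.1 k).mul (hx.2.1 i k)
  · filter_upwards [H.ae_tendsto_all] with x hx
    simp only [hd]
    exact tendsto_finsetSum _ fun k _ =>
      ((hx.2.1 j k).mul (hx.2.1 i k)).add ((hx.1 k).mul (hx.2.2 j i k))

end IsWeakSphereMap

/-! ### Integral identities for second derivatives -/

theorem integrable_mul_of_integrable_sq {f g : Plane → ℝ} (hf : Continuous f) (hg : Continuous g)
    (hf2 : Integrable (fun x => f x ^ 2) volume) (hg2 : Integrable (fun x => g x ^ 2) volume) :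
    Integrable (fun x => f x * g x) volume := by
  refine (hf2.add hg2).mono' (hf.mul hg).aestronglyMeasurable (ae_of_all _ fun x => ?_)
  simp only [Pi.add_apply]
  rw [Real.norm_eq_abs, abs_le]
  constructor <;> nlinarith [sq_nonneg (f x - g x), sq_nonneg (f x + g x)]

/-- The `L²` norms of the Hessian and of the Laplacian agree. Square integrability of the third
derivatives makes the two integrations by parts legitimate. -/
theorem integral_sq_hessian_eq {f : Plane → ℝ} (hf : ContDiff ℝ (⊤ : ℕ∞) f)
    (h1 : ∀ i, Integrable (fun x => partialD i f x ^ 2) volume)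
    (h2 : ∀ j i, Integrable (fun x => partialD j (partialD i f) x ^ 2) volume)
    (h3 : ∀ l j i, Integrable (fun x => partialD l (partialD j (partialD i f)) x ^ 2) volume) :
    ∫ x, ∑ j, ∑ i, partialD j (partialD i f) x ^ 2
      = ∫ x, (∑ i, partialD i (partialD i f) x) ^ 2 := by
  have s1 : ∀ i, ContDiff ℝ (⊤ : ℕ∞) (partialD i f) := fun i => contDiff_partialD hf i
  have s2 : ∀ j i, ContDiff ℝ (⊤ : ℕ∞) (partialD j (partialD i f)) := fun j i =>
    contDiff_partialD (s1 i) j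
  have s3 : ∀ l j i, ContDiff ℝ (⊤ : ℕ∞) (partialD l (partialD j (partialD i f))) := fun l j i =>
    contDiff_partialD (s2 j i) l
  have parts : ∀ l j i, ∫ x, partialD j (partialD i f) x * partialD l (partialD 0 f) x
      = - ∫ x, partialD l (partialD j (partialD i f)) x * partialD 0 f x := fun l j i =>
    integral_mul_partialD ((s2 j i).differentiable (by simp)) ((s1 0).differentiable (by simp))
      (integrable_mul_of_integrable_sq (s3 l j i).continuous (s1 0).continuous (h3 l j i) (h1 0))
      (integrable_mul_of_integrable_sq (s2 j i).continuous (s2 l 0).continuous (h2 j i) (h2 l 0))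
      (integrable_mul_of_integrable_sq (s2 j i).continuous (s1 0).continuous (h2 j i) (h1 0))
  have key : ∫ x, partialD 1 (partialD 1 f) x * partialD 0 (partialD 0 f) x
      = ∫ x, partialD 0 (partialD 1 f) x * partialD 0 (partialD 1 f) x := by
    have h4 := parts 1 0 1
    rw [partialD_comm (s1 1) 1 0, ← parts 0 1 1, partialD_comm hf 1 0] at h4
    exact h4.symm
  have i1 := integrable_mul_of_integrable_sq (s2 1 1).continuous (s2 0 0).continuous (h2 1 1)
    (h2 0 0)
  have i2 := integrable_mul_of_integrable_sq (s2 0 1).continuous (s2 0 1).continuous (h2 0 1)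
    (h2 0 1)
  rw [← sub_eq_zero, ← integral_sub]
  · have h5 : (fun x => ∑ j, ∑ i, partialD j (partialD i f) x ^ 2
        - (∑ i, partialD i (partialD i f) x) ^ 2)
        = fun x => 2 * (partialD 0 (partialD 1 f) x * partialD 0 (partialD 1 f) x
          - partialD 1 (partialD 1 f) x * partialD 0 (partialD 0 f) x) := by
      funext x
      simp only [Fin.sum_univ_two, partialD_comm hf 1 0]
      ring
    rw [h5, integral_const_mul, integral_sub i2 i1, key]
    ring
  · exact integrable_finsetSum _ fun j _ => integrable_finsetSum _ fun i _ => h2 j i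
  · simp only [Fin.sum_univ_two]
    refine (((h2 0 0).add (h2 1 1)).add (i1.const_mul 2)).congr (ae_of_all _ fun x => ?_)
    simp only [Pi.add_apply]
    ring

/-- The square completed in Picone's identity, integrated: testing the equation of the positive
function `w` with `η ^ 2 / w`. -/
theorem integral_sq_sub_div {η w : Plane → ℝ} {j : Fin 2} {ε : ℝ} (hε : 0 < ε)
    (hη : ContDiff ℝ (⊤ : ℕ∞) η) (hw : ContDiff ℝ (⊤ : ℕ∞) w) (hεw : ∀ x, ε ≤ w x)
    (i1 : Integrable (fun x => η x ^ 4) volume)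
    (i2 : Integrable (fun x => partialD j η x ^ 2) volume)
    (i3 : Integrable (fun x => partialD j w x ^ 2) volume)
    (i4 : Integrable (fun x => partialD j w x ^ 4) volume)
    (i5 : Integrable (fun x => partialD j (partialD j w) x ^ 2) volume) :
    ∫ x, (partialD j η x - η x * partialD j w x / w x) ^ 2
      = (∫ x, partialD j η x ^ 2) + ∫ x, partialD j (partialD j w) x * η x ^ 2 / w x := by
  have hw0 : ∀ x, w x ≠ 0 := fun x => (hε.trans_le (hεw x)).ne'
  have hinv : ∀ x, 0 < (w x)⁻¹ ∧ (w x)⁻¹ ≤ ε⁻¹ := fun x =>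
    ⟨inv_pos.2 (hε.trans_le (hεw x)), inv_anti₀ hε (hεw x)⟩
  have cη := hη.continuous
  have cη' := (contDiff_partialD hη j).continuous
  have cw := hw.continuous
  have cw' := (contDiff_partialD hw j).continuous
  have cw'' := (contDiff_partialD (contDiff_partialD hw j) j).continuous
  have ci : Continuous fun x => (w x)⁻¹ := cw.inv₀ hw0
  have dη := hη.differentiable (by simp)
  have dw := hw.differentiable (by simp)
  have dw' := (contDiff_partialD hw j).differentiable (by simp)
  have dg : Differentiable ℝ (fun x => η x ^ 2 * (w x)⁻¹) := fun x =>
    ((dη x).pow 2).mul ((dw x).inv (hw0 x))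
  have hg : ∀ x, partialD j (fun x => η x ^ 2 * (w x)⁻¹) x
      = 2 * η x * partialD j η x * (w x)⁻¹ - η x ^ 2 * partialD j w x * (w x)⁻¹ ^ 2 := by
    intro x
    have hf : HasFDerivAt (fun x => η x ^ 2 * (w x)⁻¹) _ x :=
      ((dη x).hasFDerivAt.pow 2).mul ((hasDerivAt_inv (hw0 x)).comp_hasFDerivAt x (dw x).hasFDerivAt)
    rw [partialD, hf.fderiv]
    simp [partialD]
    ring
  set B : Plane → ℝ := fun x => η x ^ 4 + partialD j η x ^ 2 + partialD j w x ^ 2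
    + partialD j w x ^ 4 + partialD j (partialD j w) x ^ 2 with hB
  have iB : Integrable B volume := (((i1.add i2).add i3).add i4).add i5
  have hmul : ∀ P : Plane → ℝ, Integrable P volume → Integrable (fun x => P x * (w x)⁻¹) volume := by
    intro P hP
    refine hP.mul_bdd (c := ε⁻¹) ci.aestronglyMeasurable (ae_of_all _ fun x => ?_)
    rw [Real.norm_of_nonneg (hinv x).1.le]
    exact (hinv x).2
  have hpoly : ∀ P : Plane → ℝ, Continuous P → (∀ x, |P x| ≤ B x) → Integrable P volume :=
    fun P hP hPB => iB.mono' hP.aestronglyMeasurable (ae_of_all _ hPB)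
  have p1 : Integrable (fun x => partialD j (partialD j w) x * (η x ^ 2 * (w x)⁻¹)) volume := by
    have h1 := hmul _ (hpoly (fun x => partialD j (partialD j w) x * η x ^ 2) (by fun_prop)
      fun x => ?_)
    · simpa only [mul_assoc] using h1
    · rw [abs_le, hB]
      constructor <;> nlinarith [sq_nonneg (partialD j (partialD j w) x + η x ^ 2),
        sq_nonneg (partialD j (partialD j w) x - η x ^ 2), sq_nonneg (partialD j η x),
        sq_nonneg (partialD j w x), sq_nonneg (partialD j w x ^ 2)]
  have p3 : Integrable (fun x => partialD j w x * (η x ^ 2 * (w x)⁻¹)) volume := by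
    have h1 := hmul _ (hpoly (fun x => partialD j w x * η x ^ 2) (by fun_prop) fun x => ?_)
    · simpa only [mul_assoc] using h1
    · rw [abs_le, hB]
      constructor <;> nlinarith [sq_nonneg (partialD j w x + η x ^ 2),
        sq_nonneg (partialD j w x - η x ^ 2), sq_nonneg (partialD j η x),
        sq_nonneg (partialD j (partialD j w) x), sq_nonneg (partialD j w x ^ 2)]
  have p2 : Integrable (fun x => partialD j w x
      * partialD j (fun x => η x ^ 2 * (w x)⁻¹) x) volume := by
    have h1 := hmul _ (hpoly (fun x => 2 * (partialD j w x * η x) * partialD j η x) (by fun_prop)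
      fun x => ?_)
    · have h2 := hmul _ (hmul _ (hpoly (fun x => partialD j w x ^ 2 * η x ^ 2) (by fun_prop)
        fun x => ?_))
      · refine (h1.sub h2).congr (ae_of_all _ fun x => ?_)
        simp only [Pi.sub_apply, hg]
        ring
      · rw [abs_le, hB]
        constructor <;> nlinarith [sq_nonneg (partialD j w x ^ 2 + η x ^ 2),
          sq_nonneg (partialD j w x ^ 2 - η x ^ 2), sq_nonneg (partialD j η x),
          sq_nonneg (partialD j (partialD j w) x), sq_nonneg (partialD j w x)]
    · have h2 : (partialD j w x * η x) ^ 2 ≤ partialD j w x ^ 4 + η x ^ 4 := by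
        nlinarith [sq_nonneg (partialD j w x ^ 2 - η x ^ 2), sq_nonneg (partialD j w x ^ 2),
          sq_nonneg (η x ^ 2)]
      rw [abs_le, hB]
      constructor <;> nlinarith [sq_nonneg (partialD j w x * η x + partialD j η x),
        sq_nonneg (partialD j w x * η x - partialD j η x),
        sq_nonneg (partialD j (partialD j w) x), sq_nonneg (partialD j w x)]
  have parts := integral_mul_partialD dw' dg p1 p2 p3
  have e1 : (fun x => (partialD j η x - η x * partialD j w x / w x) ^ 2) = fun x =>
      partialD j η x ^ 2 - partialD j w x * partialD j (fun x => η x ^ 2 * (w x)⁻¹) x := by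
    funext x
    rw [hg]
    field_simp [hw0 x]
    ring
  have e2 : (fun x => partialD j (partialD j w) x * η x ^ 2 / w x)
      = fun x => partialD j (partialD j w) x * (η x ^ 2 * (w x)⁻¹) := by
    funext x
    rw [div_eq_mul_inv, mul_assoc]
  rw [e1, e2, integral_sub i2 p2, parts]
  ring

namespace IsWeakSphereMap

variable {d : Fin 3 → Plane → ℝ} {u : Fin 2 → Fin 3 → Plane → ℝ}
  {h : Fin 2 → Fin 2 → Fin 3 → Plane → ℝ}

theorem integral_sq_hessian_eq (H : IsWeakSphereMap d u h) :
    ∫ x, ∑ k, ∑ j, ∑ i, h j i k x ^ 2 = ∫ x, ∑ k, (∑ i, h i i k x) ^ 2 := by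
  have key : ∀ k, ∫ x, ∑ j, ∑ i, h j i k x ^ 2 = ∫ x, (∑ i, h i i k x) ^ 2 := by
    intro k
    have e : ∀ n, ∫ x, ∑ j, ∑ i, mollify n (h j i k) x ^ 2
        = ∫ x, (∑ i, mollify n (h i i k) x) ^ 2 := by
      intro n
      have h1 : ∀ i, partialD i (mollify n (d k)) = mollify n (u i k) := fun i =>
        H.partialD_mollify_d n i k
      have h2 : ∀ j i, partialD j (mollify n (u i k)) = mollify n (h j i k) := fun j i =>
        H.partialD_mollify_u n j i k
      have h3 := _root_.integral_sq_hessian_eq (H.contDiff_d n k)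
      simp only [h1, h2] at h3
      refine h3 (fun i => ?_) (fun j i => ?_) fun l j i => ?_
      · exact integrable_of_le_mollify (a := 0) (C := 1) H.integrable_energySum
          (integrable_zero _ _ _) ((H.contDiff_u n i k).continuous.pow 2) fun x => by
            simpa using H.sq_mollify_u_le n i k x
      · exact integrable_of_le_mollify (a := 0) (C := 1) H.integrable_energySum
          (integrable_zero _ _ _) ((H.contDiff_h n j i k).continuous.pow 2) fun x => by
            simpa using H.sq_mollify_h_le n j i k x
      · exact integrable_sq_partialD_mollify n (H.loc_h j i k) (H.sq_h j i k) l
    have t1 : Tendsto (fun n => ∫ x, ∑ j, ∑ i, mollify n (h j i k) x ^ 2) atTop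
        (𝓝 (∫ x, ∑ j, ∑ i, h j i k x ^ 2)) := by
      refine tendsto_integral_of_le_mollify (a := 0) (C := 4) H.integrable_energySum
        (integrable_zero _ _ _) (fun n => ?_) (fun n x => ?_) ?_
      · exact continuous_finsetSum _ fun j _ => continuous_finsetSum _ fun i _ =>
          (H.contDiff_h n j i k).continuous.pow 2
      · have h1 := fun j i => H.sq_mollify_h_le n j i k x
        rw [abs_of_nonneg (by positivity)]
        simp only [Fin.sum_univ_two, Pi.zero_apply]
        linarith [h1 0 0, h1 0 1, h1 1 0, h1 1 1]
      · filter_upwards [H.ae_tendsto_all] with x hx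
        exact tendsto_finsetSum _ fun j _ => tendsto_finsetSum _ fun i _ => (hx.2.2 j i k).pow 2
    have t2 : Tendsto (fun n => ∫ x, (∑ i, mollify n (h i i k) x) ^ 2) atTop
        (𝓝 (∫ x, (∑ i, h i i k x) ^ 2)) := by
      refine tendsto_integral_of_le_mollify (a := 0) (C := 4) H.integrable_energySum
        (integrable_zero _ _ _) (fun n => ?_) (fun n x => ?_) ?_
      · exact (continuous_finsetSum _ fun i _ => (H.contDiff_h n i i k).continuous).pow 2
      · have h1 := fun j i => H.sq_mollify_h_le n j i k x
        rw [abs_of_nonneg (by positivity)]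
        simp only [Fin.sum_univ_two, Pi.zero_apply]
        nlinarith [h1 0 0, h1 1 1, sq_nonneg (mollify n (h 0 0 k) x - mollify n (h 1 1 k) x)]
      · filter_upwards [H.ae_tendsto_all] with x hx
        exact (tendsto_finsetSum _ fun i _ => hx.2.2 i i k).pow 2
    exact tendsto_nhds_unique t1 (t2.congr fun n => (e n).symm)
  rw [integral_finsetSum _ fun k _ => ?_, integral_finsetSum _ fun k _ => ?_]
  · exact Finset.sum_congr rfl fun k _ => key k
  · have h1 : Integrable (fun x => 2 * h 0 0 k x ^ 2 + 2 * h 1 1 k x ^ 2) volume :=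
      ((H.sq_h 0 0 k).const_mul 2).add ((H.sq_h 1 1 k).const_mul 2)
    simp only [Fin.sum_univ_two]
    refine h1.mono' ?_ (ae_of_all _ fun x => ?_)
    · exact ((H.loc_h 0 0 k).aestronglyMeasurable.add
        (H.loc_h 1 1 k).aestronglyMeasurable).pow 2
    · rw [Real.norm_of_nonneg (sq_nonneg _)]
      nlinarith [sq_nonneg (h 0 0 k x - h 1 1 k x)]
  · exact integrable_finsetSum _ fun j _ => integrable_finsetSum _ fun i _ => H.sq_h j i k

/-- On the sphere `|∂ᵢd|² = -∂ᵢ∂ᵢd · d`, so `∇d ∈ L⁴` without any Sobolev embedding. -/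
theorem integrable_pow_four_u (H : IsWeakSphereMap d u h) (i : Fin 2) (k : Fin 3) :
    Integrable (fun x => u i k x ^ 4) volume := by
  have h1 : Integrable (fun x => ∑ k, h i i k x ^ 2) volume :=
    integrable_finsetSum _ fun k _ => H.sq_h i i k
  refine h1.mono' ((H.loc_u i k).aestronglyMeasurable.pow 4) ?_
  filter_upwards [H.sphere, H.sum_d_mul_h i i] with x h2 h3
  have h4 := Finset.sum_mul_sq_le_sq_mul_sq Finset.univ (fun k => d k x) (fun k => h i i k x)
  rw [h2, h3, one_mul, neg_sq] at h4
  have h5 : u i k x ^ 2 ≤ ∑ k, u i k x * u i k x := by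
    rw [pow_two]
    exact Finset.single_le_sum (f := fun k => u i k x * u i k x) (fun k _ => mul_self_nonneg _)
      (Finset.mem_univ k)
  rw [Real.norm_of_nonneg (by positivity)]
  nlinarith [sq_nonneg (u i k x)]

/-- The sum of the squares of all derivatives and of the fourth powers of the first ones. -/
noncomputable def energySumFour (u : Fin 2 → Fin 3 → Plane → ℝ)
    (h : Fin 2 → Fin 2 → Fin 3 → Plane → ℝ) (x : Plane) : ℝ :=
  energySum u h x + ∑ i, ∑ k, u i k x ^ 4

theorem integral_sq_hessian_sub (H : IsWeakSphereMap d u h) {ε : ℝ} (hε : 0 < ε)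
    (hd : ∀ᵐ x, ε ≤ d 2 x) (j i : Fin 2) (k : Fin 3) :
    Integrable (fun x => (h j i k x - u i k x * u j 2 x / d 2 x) ^ 2) volume ∧
    Integrable (fun x => h j j 2 x * u i k x ^ 2 / d 2 x) volume ∧
    ∫ x, (h j i k x - u i k x * u j 2 x / d 2 x) ^ 2
      = (∫ x, h j i k x ^ 2) + ∫ x, h j j 2 x * u i k x ^ 2 / d 2 x := by
  set S := energySumFour u h with hSdef
  have hS : Integrable S volume := H.integrable_energySum.add <|
    integrable_finsetSum _ fun i _ => integrable_finsetSum _ fun k _ => H.integrable_pow_four_u i k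
  have le1 : ∀ x, energySum u h x ≤ S x := fun x =>
    le_add_of_nonneg_right (Finset.sum_nonneg fun i _ => Finset.sum_nonneg fun k _ => by positivity)
  have le4 : ∀ i k x, u i k x ^ 4 ≤ S x := by
    intro i k x
    have h1 : u i k x ^ 4 ≤ ∑ k, u i k x ^ 4 :=
      Finset.single_le_sum (f := fun k => u i k x ^ 4) (fun k _ => by positivity)
        (Finset.mem_univ k)
    have h2 : ∑ k, u i k x ^ 4 ≤ ∑ i, ∑ k, u i k x ^ 4 :=
      Finset.single_le_sum (f := fun i => ∑ k, u i k x ^ 4)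
        (fun i _ => Finset.sum_nonneg fun k _ => by positivity) (Finset.mem_univ i)
    have h3 := (sq_nonneg _).trans (sq_u_le_energySum (u := u) (h := h) i k x)
    rw [hSdef, energySumFour]
    linarith
  have bu : ∀ n i k x, mollify n (u i k) x ^ 2 ≤ mollify n S x := fun n i k x =>
    sq_mollify_le_of_sq_le (H.loc_u i k) (H.sq_u i k) hS
      (ae_of_all _ fun x => (sq_u_le_energySum i k x).trans (le1 x)) n x
  have bh : ∀ n j i k x, mollify n (h j i k) x ^ 2 ≤ mollify n S x := fun n j i k x =>
    sq_mollify_le_of_sq_le (H.loc_h j i k) (H.sq_h j i k) hS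
      (ae_of_all _ fun x => (sq_h_le_energySum j i k x).trans (le1 x)) n x
  have bu4 : ∀ n i k x, mollify n (u i k) x ^ 4 ≤ mollify n S x := fun n i k x =>
    pow_four_mollify_le_of_pow_four_le (H.loc_u i k) (H.sq_u i k) (H.integrable_pow_four_u i k) hS
      (ae_of_all _ fun x => le4 i k x) n x
  have hw : ∀ n x, ε ≤ mollify n (d 2) x := fun n x => le_mollify n (H.loc_d 2) hd x
  have hw0 : ∀ n x, mollify n (d 2) x ≠ 0 := fun n x => (hε.trans_le (hw n x)).ne'
  have hinv : ∀ n x, 0 < (mollify n (d 2) x)⁻¹ ∧ (mollify n (d 2) x)⁻¹ ≤ ε⁻¹ := fun n x =>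
    ⟨inv_pos.2 (hε.trans_le (hw n x)), inv_anti₀ hε (hw n x)⟩
  have cu : ∀ n i k, Continuous (mollify n (u i k)) := fun n i k => (H.contDiff_u n i k).continuous
  have ch : ∀ n j i k, Continuous (mollify n (h j i k)) := fun n j i k =>
    (H.contDiff_h n j i k).continuous
  have cd : ∀ n k, Continuous (mollify n (d k)) := fun n k => (H.contDiff_d n k).continuous
  have e : ∀ n, ∫ x, (mollify n (h j i k) x - mollify n (u i k) x * mollify n (u j 2) x
        / mollify n (d 2) x) ^ 2
      = (∫ x, mollify n (h j i k) x ^ 2)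
        + ∫ x, mollify n (h j j 2) x * mollify n (u i k) x ^ 2 / mollify n (d 2) x := by
    intro n
    have intg : ∀ P : Plane → ℝ, Continuous P → (∀ x, |P x| ≤ mollify n S x) →
        Integrable P volume := fun P hP hle =>
      integrable_of_le_mollify (a := 0) (C := 1) hS (integrable_zero _ _ _) hP fun x => by
        simpa using hle x
    have h1 := integral_sq_sub_div (j := j) hε (H.contDiff_u n i k) (H.contDiff_d n 2) (hw n)
    simp only [H.partialD_mollify_d, H.partialD_mollify_u] at h1
    refine h1 (intg _ ((cu n i k).pow 4) fun x => ?_) (intg _ ((ch n j i k).pow 2) fun x => ?_)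
      (intg _ ((cu n j 2).pow 2) fun x => ?_) (intg _ ((cu n j 2).pow 4) fun x => ?_)
      (intg _ ((ch n j j 2).pow 2) fun x => ?_)
    · rw [abs_of_nonneg (by positivity)]; exact bu4 n i k x
    · rw [abs_of_nonneg (by positivity)]; exact bh n j i k x
    · rw [abs_of_nonneg (by positivity)]; exact bu n j 2 x
    · rw [abs_of_nonneg (by positivity)]; exact bu4 n j 2 x
    · rw [abs_of_nonneg (by positivity)]; exact bh n j j 2 x
  have c1 : ∀ n, Continuous fun x => (mollify n (h j i k) x
      - mollify n (u i k) x * mollify n (u j 2) x / mollify n (d 2) x) ^ 2 := fun n =>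
    ((ch n j i k).sub (((cu n i k).mul (cu n j 2)).div (cd n 2) (hw0 n))).pow 2
  have c3 : ∀ n, Continuous fun x =>
      mollify n (h j j 2) x * mollify n (u i k) x ^ 2 / mollify n (d 2) x := fun n =>
    ((ch n j j 2).mul ((cu n i k).pow 2)).div (cd n 2) (hw0 n)
  have b1 : ∀ n x, |(mollify n (h j i k) x
      - mollify n (u i k) x * mollify n (u j 2) x / mollify n (d 2) x) ^ 2|
      ≤ (0 : Plane → ℝ) x + (2 + 2 * ε⁻¹ ^ 2) * mollify n S x := by
    intro n x
    have h1 := bh n j i k x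
    have h2 : (mollify n (u i k) x * mollify n (u j 2) x) ^ 2 ≤ mollify n S x := by
      nlinarith [bu4 n i k x, bu4 n j 2 x,
        sq_nonneg (mollify n (u i k) x ^ 2 - mollify n (u j 2) x ^ 2)]
    have h3 : (mollify n (u i k) x * mollify n (u j 2) x / mollify n (d 2) x) ^ 2
        ≤ mollify n S x * ε⁻¹ ^ 2 := by
      rw [div_eq_mul_inv, mul_pow]
      exact mul_le_mul h2 (pow_le_pow_left₀ (hinv n x).1.le (hinv n x).2 2) (sq_nonneg _)
        ((sq_nonneg _).trans h1)
    rw [abs_of_nonneg (sq_nonneg _), Pi.zero_apply]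
    nlinarith [sq_nonneg (mollify n (h j i k) x
      + mollify n (u i k) x * mollify n (u j 2) x / mollify n (d 2) x)]
  have b3 : ∀ n x, |mollify n (h j j 2) x * mollify n (u i k) x ^ 2 / mollify n (d 2) x|
      ≤ (0 : Plane → ℝ) x + ε⁻¹ * mollify n S x := by
    intro n x
    have h1 := bh n j j 2 x
    have h2 : |mollify n (h j j 2) x * mollify n (u i k) x ^ 2| ≤ mollify n S x := by
      rw [abs_le]
      constructor <;> nlinarith [bu4 n i k x,
        sq_nonneg (mollify n (h j j 2) x - mollify n (u i k) x ^ 2),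
        sq_nonneg (mollify n (h j j 2) x + mollify n (u i k) x ^ 2)]
    rw [div_eq_mul_inv, abs_mul, abs_of_pos (hinv n x).1, Pi.zero_apply, zero_add, mul_comm ε⁻¹]
    exact mul_le_mul h2 (hinv n x).2 (hinv n x).1.le ((sq_nonneg _).trans h1)
  have hlim : ∀ᵐ x, 0 < d 2 x ∧
      (∀ k, Tendsto (fun n => mollify n (d k) x) atTop (𝓝 (d k x))) ∧
      (∀ i k, Tendsto (fun n => mollify n (u i k) x) atTop (𝓝 (u i k x))) ∧
      ∀ j i k, Tendsto (fun n => mollify n (h j i k) x) atTop (𝓝 (h j i k x)) := by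
    filter_upwards [H.ae_tendsto_all, hd] with x hx hx' using ⟨hε.trans_le hx', hx⟩
  have l1 : ∀ᵐ x, Tendsto (fun n => (mollify n (h j i k) x
      - mollify n (u i k) x * mollify n (u j 2) x / mollify n (d 2) x) ^ 2) atTop
      (𝓝 ((h j i k x - u i k x * u j 2 x / d 2 x) ^ 2)) := by
    filter_upwards [hlim] with x ⟨h0, hd', hu', hh'⟩
    exact ((hh' j i k).sub (((hu' i k).mul (hu' j 2)).div (hd' 2) h0.ne')).pow 2
  have l3 : ∀ᵐ x, Tendsto (fun n => mollify n (h j j 2) x * mollify n (u i k) x ^ 2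
      / mollify n (d 2) x) atTop (𝓝 (h j j 2 x * u i k x ^ 2 / d 2 x)) := by
    filter_upwards [hlim] with x ⟨h0, hd', hu', hh'⟩
    exact ((hh' j j 2).mul ((hu' i k).pow 2)).div (hd' 2) h0.ne'
  have i0 : Integrable (0 : Plane → ℝ) volume := integrable_zero _ _ _
  refine ⟨integrable_of_tendsto_of_le_mollify hS i0 c1 b1 l1,
    integrable_of_tendsto_of_le_mollify hS i0 c3 b3 l3, ?_⟩
  have t1 := tendsto_integral_of_le_mollify hS i0 c1 b1 l1
  have t3 := tendsto_integral_of_le_mollify hS i0 c3 b3 l3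
  have t2 : Tendsto (fun n => ∫ x, mollify n (h j i k) x ^ 2) atTop
      (𝓝 (∫ x, h j i k x ^ 2)) := by
    refine tendsto_integral_of_le_mollify hS i0 (C := 1) (fun n => (ch n j i k).pow 2)
      (fun n x => ?_) ?_
    · rw [abs_of_nonneg (sq_nonneg _), Pi.zero_apply, zero_add, one_mul]
      exact bh n j i k x
    · filter_upwards [hlim] with x hx using (hx.2.2.2 j i k).pow 2
  exact tendsto_nhds_unique t1 ((t2.add t3).congr fun n => (e n).symm)

end IsWeakSphereMap

/-! ### The coercivity estimate -/

namespace IsWeakSphereMap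

variable {d : Fin 3 → Plane → ℝ} {u : Fin 2 → Fin 3 → Plane → ℝ}
  {h : Fin 2 → Fin 2 → Fin 3 → Plane → ℝ}

/-- The tension is the tangential part of the Laplacian, and `-|∇d|²` the normal part. -/
theorem sum_sq_tension (H : IsWeakSphereMap d u h) :
    ∀ᵐ x, ∑ k, (∑ i, h i i k x + (∑ i, ∑ k, u i k x ^ 2) * d k x) ^ 2
      = ∑ k, (∑ i, h i i k x) ^ 2 - (∑ i, ∑ k, u i k x ^ 2) ^ 2 := by
  filter_upwards [H.sphere, H.sum_d_mul_h 0 0, H.sum_d_mul_h 1 1] with x h1 h2 h3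
  simp only [Fin.sum_univ_two, Fin.sum_univ_three] at *
  linear_combination (u 0 0 x ^ 2 + u 0 1 x ^ 2 + u 0 2 x ^ 2
    + (u 1 0 x ^ 2 + u 1 1 x ^ 2 + u 1 2 x ^ 2)) * (2 * h2 + 2 * h3)
    + (u 0 0 x ^ 2 + u 0 1 x ^ 2 + u 0 2 x ^ 2
    + (u 1 0 x ^ 2 + u 1 1 x ^ 2 + u 1 2 x ^ 2)) ^ 2 * h1

/-- Since `∂ᵢd` is tangential, the normal component of `∂ⱼ∂ᵢd - (∂ⱼw / w) ∂ᵢd` is `-∂ᵢd · ∂ⱼd`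
for every function `w`. -/
theorem half_sq_le_sum_sq_sub (H : IsWeakSphereMap d u h) :
    ∀ᵐ x, (∑ i, ∑ k, u i k x ^ 2) ^ 2 / 2
      ≤ ∑ k, ∑ j, ∑ i, (h j i k x - u i k x * u j 2 x / d 2 x) ^ 2 := by
  have a1 : ∀ᵐ x, ∀ i, ∑ k, d k x * u i k x = 0 := ae_all_iff.2 H.sum_d_mul_u
  have a2 : ∀ᵐ x, ∀ j i, ∑ k, d k x * h j i k x = - ∑ k, u j k x * u i k x :=
    ae_all_iff.2 fun j => ae_all_iff.2 (H.sum_d_mul_h j)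
  filter_upwards [H.sphere, a1, a2] with x h1 h2 h3
  have key : ∀ j i, (∑ k, u j k x * u i k x) ^ 2
      ≤ ∑ k, (h j i k x - u i k x * u j 2 x / d 2 x) ^ 2 := by
    intro j i
    have h4 := Finset.sum_mul_sq_le_sq_mul_sq Finset.univ (fun k => d k x)
      (fun k => h j i k x - u i k x * u j 2 x / d 2 x)
    have h5 : ∑ k, d k x * (h j i k x - u i k x * u j 2 x / d 2 x)
        = - ∑ k, u j k x * u i k x := by
      have h6 : ∀ k, d k x * (h j i k x - u i k x * u j 2 x / d 2 x)
          = d k x * h j i k x - d k x * u i k x * (u j 2 x / d 2 x) := fun k => by ring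
      simp only [h6, Finset.sum_sub_distrib, ← Finset.sum_mul, h2 i, h3 j i]
      ring
    rwa [h1, h5, one_mul, neg_sq] at h4
  have e : ∑ k, ∑ j, ∑ i, (h j i k x - u i k x * u j 2 x / d 2 x) ^ 2
      = ∑ j, ∑ i, ∑ k, (h j i k x - u i k x * u j 2 x / d 2 x) ^ 2 := by
    rw [Finset.sum_comm]
    exact Finset.sum_congr rfl fun j _ => Finset.sum_comm
  have h4 : ∑ j, ∑ i, (∑ k, u j k x * u i k x) ^ 2
      ≤ ∑ j, ∑ i, ∑ k, (h j i k x - u i k x * u j 2 x / d 2 x) ^ 2 :=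
    Finset.sum_le_sum fun j _ => Finset.sum_le_sum fun i _ => key j i
  rw [e]
  refine le_trans ?_ h4
  simp only [← pow_two, Fin.sum_univ_two]
  nlinarith [sq_nonneg (∑ k, u 0 k x ^ 2 - ∑ k, u 1 k x ^ 2),
    sq_nonneg (∑ k, u 0 k x * u 1 k x), sq_nonneg (∑ k, u 1 k x * u 0 k x)]

theorem integrable_sq_sum_sq_u (H : IsWeakSphereMap d u h) :
    Integrable (fun x => (∑ i, ∑ k, u i k x ^ 2) ^ 2) volume := by
  have h1 : Integrable (fun x => 6 * ∑ i, ∑ k, u i k x ^ 4) volume :=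
    (integrable_finsetSum _ fun i _ => integrable_finsetSum _ fun k _ =>
      H.integrable_pow_four_u i k).const_mul 6
  refine h1.mono' (AEStronglyMeasurable.pow (Finset.aestronglyMeasurable_fun_sum _ fun i _ =>
    Finset.aestronglyMeasurable_fun_sum _ fun k _ => (H.loc_u i k).aestronglyMeasurable.pow 2) 2)
    (ae_of_all _ fun x => ?_)
  rw [Real.norm_of_nonneg (sq_nonneg _)]
  have h2 := sq_sum_le_card_mul_sum_sq (s := (Finset.univ : Finset (Fin 2 × Fin 3)))
    (f := fun p => u p.1 p.2 x ^ 2)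
  rw [Fintype.sum_prod_type, Fintype.sum_prod_type] at h2
  refine h2.trans (le_of_eq ?_)
  simp [← pow_mul]

theorem integrable_sq_laplacian (H : IsWeakSphereMap d u h) :
    Integrable (fun x => ∑ k, (∑ i, h i i k x) ^ 2) volume := by
  refine integrable_finsetSum _ fun k _ => ?_
  have h1 : Integrable (fun x => 2 * ∑ i, h i i k x ^ 2) volume :=
    (integrable_finsetSum _ fun i _ => H.sq_h i i k).const_mul 2
  refine h1.mono' (AEStronglyMeasurable.pow (Finset.aestronglyMeasurable_fun_sum _ fun i _ =>
    (H.loc_h i i k).aestronglyMeasurable) 2) (ae_of_all _ fun x => ?_)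
  rw [Real.norm_of_nonneg (sq_nonneg _)]
  simpa using sq_sum_le_card_mul_sum_sq (s := Finset.univ) (f := fun i => h i i k x)

/-- The quantitative estimate: `‖∇d‖₄⁴` is controlled by the energy
`‖Δd‖₂² - ‖∇d‖₄⁴` of the tension. -/
theorem integral_sq_sum_sq_u_le (H : IsWeakSphereMap d u h) {ε : ℝ} (hε : 0 < ε)
    (hd : ∀ᵐ x, ε ≤ d 2 x) :
    ∫ x, (∑ i, ∑ k, u i k x ^ 2) ^ 2 ≤ 4 * (1 + ε⁻¹ ^ 2) *
      ((∫ x, ∑ k, (∑ i, h i i k x) ^ 2) - ∫ x, (∑ i, ∑ k, u i k x ^ 2) ^ 2) := by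
  have hP := fun j i k => H.integral_sq_hessian_sub hε hd j i k
  have iA := H.integrable_sq_sum_sq_u
  have iB := H.integrable_sq_laplacian
  have iQ : Integrable (fun x => ∑ k, ∑ j, ∑ i,
      (h j i k x - u i k x * u j 2 x / d 2 x) ^ 2) volume :=
    integrable_finsetSum _ fun k _ => integrable_finsetSum _ fun j _ =>
      integrable_finsetSum _ fun i _ => (hP j i k).1
  have iR : Integrable (fun x => ∑ k, ∑ j, ∑ i, h j j 2 x * u i k x ^ 2 / d 2 x) volume :=
    integrable_finsetSum _ fun k _ => integrable_finsetSum _ fun j _ =>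
      integrable_finsetSum _ fun i _ => (hP j i k).2.1
  have eQ : ∫ x, ∑ k, ∑ j, ∑ i, (h j i k x - u i k x * u j 2 x / d 2 x) ^ 2
      = (∫ x, ∑ k, ∑ j, ∑ i, h j i k x ^ 2)
        + ∫ x, ∑ k, ∑ j, ∑ i, h j j 2 x * u i k x ^ 2 / d 2 x := by
    have s : ∀ f : Fin 3 → Fin 2 → Fin 2 → Plane → ℝ, (∀ k j i, Integrable (f k j i) volume) →
        ∫ x, ∑ k, ∑ j, ∑ i, f k j i x = ∑ k, ∑ j, ∑ i, ∫ x, f k j i x := by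
      intro f hf
      rw [integral_finsetSum _ fun k _ => integrable_finsetSum _ fun j _ =>
        integrable_finsetSum _ fun i _ => hf k j i]
      refine Finset.sum_congr rfl fun k _ => ?_
      rw [integral_finsetSum _ fun j _ => integrable_finsetSum _ fun i _ => hf k j i]
      refine Finset.sum_congr rfl fun j _ => ?_
      rw [integral_finsetSum _ fun i _ => hf k j i]
    rw [s _ fun k j i => (hP j i k).1, s _ fun k j i => H.sq_h j i k,
      s _ fun k j i => (hP j i k).2.1]
    simp only [(hP _ _ _).2.2, Finset.sum_add_distrib]
  have lower : ∫ x, (∑ i, ∑ k, u i k x ^ 2) ^ 2 / 2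
      ≤ ∫ x, ∑ k, ∑ j, ∑ i, (h j i k x - u i k x * u j 2 x / d 2 x) ^ 2 :=
    integral_mono_ae (iA.div_const 2) iQ H.half_sq_le_sum_sq_sub
  have iU : Integrable (fun x => ε⁻¹ ^ 2 * (∑ k, (∑ i, h i i k x) ^ 2
      - (∑ i, ∑ k, u i k x ^ 2) ^ 2) - 3 / 4 * (∑ i, ∑ k, u i k x ^ 2) ^ 2) volume :=
    ((iB.sub iA).const_mul _).sub (iA.const_mul _)
  have upper : ∫ x, ∑ k, ∑ j, ∑ i, h j j 2 x * u i k x ^ 2 / d 2 x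
      ≤ ∫ x, (ε⁻¹ ^ 2 * (∑ k, (∑ i, h i i k x) ^ 2
        - (∑ i, ∑ k, u i k x ^ 2) ^ 2) - 3 / 4 * (∑ i, ∑ k, u i k x ^ 2) ^ 2) := by
    refine integral_mono_ae iR iU ?_
    filter_upwards [H.sum_sq_tension, hd] with x hτ hx
    have hw : 0 < d 2 x := hε.trans_le hx
    set N := ∑ i, ∑ k, u i k x ^ 2 with hN
    set τ := ∑ i, h i i 2 x + N * d 2 x with hτdef
    have e1 : ∑ k, ∑ j, ∑ i, h j j 2 x * u i k x ^ 2 / d 2 x = τ * (d 2 x)⁻¹ * N - N ^ 2 := by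
      have : ∑ k, ∑ j, ∑ i, h j j 2 x * u i k x ^ 2 / d 2 x
          = (∑ i, h i i 2 x) * N / d 2 x := by
        simp only [hN, Fin.sum_univ_two, Fin.sum_univ_three]
        ring
      rw [this, hτdef]
      field_simp
      ring
    have e2 : τ ^ 2 ≤ ∑ k, (∑ i, h i i k x) ^ 2 - N ^ 2 := by
      rw [← hτ]
      exact Finset.single_le_sum (f := fun k => (∑ i, h i i k x + N * d k x) ^ 2)
        (fun k _ => sq_nonneg _) (Finset.mem_univ 2)
    have e3 : (τ * (d 2 x)⁻¹) ^ 2 ≤ ε⁻¹ ^ 2 * (∑ k, (∑ i, h i i k x) ^ 2 - N ^ 2) := by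
      rw [mul_pow, mul_comm]
      exact mul_le_mul (pow_le_pow_left₀ (inv_nonneg.2 hw.le) (inv_anti₀ hε hx) 2) e2
        (sq_nonneg _) (by positivity)
    rw [e1]
    nlinarith [sq_nonneg (τ * (d 2 x)⁻¹ - N / 2)]
  rw [integral_sub (by exact (iB.sub iA).const_mul _) (iA.const_mul _), integral_const_mul,
    integral_const_mul, integral_sub iB iA] at upper
  rw [integral_div] at lower
  rw [eQ, H.integral_sq_hessian_eq] at lower
  linarith

end IsWeakSphereMap

/-! ### Components and norms -/

theorem HasWeakPartial.clm_comp {F G : Type} [NormedAddCommGroup F] [NormedSpace ℝ F]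
    [CompleteSpace F] [NormedAddCommGroup G] [NormedSpace ℝ G] [CompleteSpace G] {i : Fin 2}
    {f g : Plane → F} (h : HasWeakPartial i f g) (L : F →L[ℝ] G) :
    HasWeakPartial i (fun x => L (f x)) (fun x => L (g x)) := by
  obtain ⟨hf, hg, hφ⟩ := h
  refine ⟨fun y => let ⟨s, hs, hi⟩ := hf y; ⟨s, hs, L.integrable_comp hi⟩,
    fun y => let ⟨s, hs, hi⟩ := hg y; ⟨s, hs, L.integrable_comp hi⟩, fun φ h1 h2 => ?_⟩
  have i1 : Integrable (fun x => fderiv ℝ φ x (EuclideanSpace.single i 1) • f x) volume :=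
    hf.integrable_smul_left_of_hasCompactSupport
      ((h1.continuous_fderiv (by simp)).clm_apply continuous_const) (h2.fderiv_apply ℝ _)
  have i2 : Integrable (fun x => φ x • g x) volume :=
    hg.integrable_smul_left_of_hasCompactSupport h1.continuous h2
  simp only [← map_smul]
  rw [L.integral_comp_comm i1, L.integral_comp_comm i2, hφ φ h1 h2, map_neg]

theorem eLpNorm_natCast_pow_eq_ofReal_integral {F : Type*} [NormedAddCommGroup F] {f : Plane → F}
    {m : ℕ} (hm : m ≠ 0) (hf : Integrable (fun x => ‖f x‖ ^ m) volume) :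
    eLpNorm f m volume ^ m = ENNReal.ofReal (∫ x, ‖f x‖ ^ m) := by
  have h1 := eLpNorm_nnreal_pow_eq_lintegral (f := f) (μ := (volume : Measure Plane))
    (p := (m : NNReal)) (by exact_mod_cast hm)
  simp only [NNReal.coe_natCast, ENNReal.rpow_natCast, ENNReal.coe_natCast] at h1
  rw [h1, ofReal_integral_eq_lintegral_ofReal hf (ae_of_all _ fun x => by positivity)]
  refine lintegral_congr fun x => ?_
  rw [ENNReal.ofReal_pow (norm_nonneg _), ofReal_norm]

theorem norm_sq_gradSpace_space3 (v : GradSpace Space3) : ‖v‖ ^ 2 = ∑ i, ∑ k, v i k ^ 2 := by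
  rw [PiLp.norm_sq_eq_of_L2]
  exact Finset.sum_congr rfl fun i _ => by rw [EuclideanSpace.real_norm_sq_eq]

/-- The scalar components of a sphere-valued map with `∇d ∈ H¹`. -/
theorem isWeakSphereMap_components {d : Plane → Space3} {Dd : Plane → GradSpace Space3}
    {D2d : Plane → GradSpace (GradSpace Space3)} (hd : ∀ᵐ x, ‖d x‖ = 1)
    (hDd : HasWeakGrad d Dd) (hD2d : MemH1WithGrad Dd D2d) :
    IsWeakSphereMap (fun k x => d x k) (fun i k x => Dd x i k) (fun j i k x => D2d x j i k) where
  weak_u i k := (hDd i).clm_comp (EuclideanSpace.proj k)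
  weak_h j i k := (hD2d.2.1 j).clm_comp
    ((EuclideanSpace.proj k : Space3 →L[ℝ] ℝ).comp (PiLp.proj 2 (fun _ : Fin 2 => Space3) i))
  sq_u i k := by
    have h1 : MemLp (fun x => Dd x i k) 2 volume :=
      ((EuclideanSpace.proj k : Space3 →L[ℝ] ℝ).comp
        (PiLp.proj 2 (fun _ : Fin 2 => Space3) i)).comp_memLp' hD2d.1
    exact h1.integrable_sq
  sq_h j i k := by
    have h1 : MemLp (fun x => D2d x j i k) 2 volume :=
      (((EuclideanSpace.proj k : Space3 →L[ℝ] ℝ).comp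
        (PiLp.proj 2 (fun _ : Fin 2 => Space3) i)).comp
        (PiLp.proj 2 (fun _ : Fin 2 => GradSpace Space3) j)).comp_memLp' hD2d.2.2
    exact h1.integrable_sq
  sphere := by
    filter_upwards [hd] with x hx
    rw [← EuclideanSpace.real_norm_sq_eq, hx, one_pow]

theorem theorem2 (ε₀ C₀ : ℝ) (hε₀ : 0 < ε₀) (hC₀ : 0 < C₀) :
    ∃ δ₀ : ℝ, 0 < δ₀ ∧
      ∀ (d : Plane → Space3) (Dd : Plane → GradSpace Space3)
        (D2d : Plane → GradSpace (GradSpace Space3)),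
        (∀ᵐ x ∂(volume : Measure Plane), ‖d x‖ = 1) →
        HasWeakGrad d Dd →
        MemH1WithGrad Dd D2d →
        eLpNorm Dd 2 volume ≤ ENNReal.ofReal C₀ →
        (∀ᵐ x ∂(volume : Measure Plane), ε₀ ≤ d x 2) →
        eLpNorm Dd 4 volume ^ 4 ≤
            ENNReal.ofReal (1 - δ₀) * eLpNorm (laplacianOfHessian D2d) 2 volume ^ 2 ∧
          ENNReal.ofReal (δ₀ / 2) *
              (eLpNorm (laplacianOfHessian D2d) 2 volume ^ 2 + eLpNorm Dd 4 volume ^ 4) ≤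
            eLpNorm (harmonicTension d Dd D2d) 2 volume ^ 2 := by
  set M : ℝ := 4 * (1 + ε₀⁻¹ ^ 2) with hM
  have hM0 : 0 < M := by positivity
  -- `A ≤ M (B - A)` is equivalent to `A ≤ (1 - 1 / (1 + M)) B`.
  refine ⟨1 / (1 + M), by positivity, fun d Dd D2d hd hDd hD2d _ hpos => ?_⟩
  have H := isWeakSphereMap_components hd hDd hD2d
  have hmain := H.integral_sq_sum_sq_u_le hε₀ hpos
  have iA := H.integrable_sq_sum_sq_u
  have iB := H.integrable_sq_laplacian
  have hτ := H.sum_sq_tension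
  have nD : ∀ x, ‖Dd x‖ ^ 2 = ∑ i, ∑ k, Dd x i k ^ 2 := fun x => norm_sq_gradSpace_space3 _
  have n4 : ∀ x, ‖Dd x‖ ^ 4 = (∑ i, ∑ k, Dd x i k ^ 2) ^ 2 := fun x => by rw [← nD]; ring
  have nL : ∀ x, ‖laplacianOfHessian D2d x‖ ^ 2 = ∑ k, (∑ i, D2d x i i k) ^ 2 := fun x => by
    rw [EuclideanSpace.real_norm_sq_eq]
    refine Finset.sum_congr rfl fun k _ => ?_
    simp [laplacianOfHessian]
  have nT : ∀ᵐ x, ‖harmonicTension d Dd D2d x‖ ^ 2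
      = ∑ k, (∑ i, D2d x i i k) ^ 2 - (∑ i, ∑ k, Dd x i k ^ 2) ^ 2 := by
    filter_upwards [hτ] with x hx
    rw [← hx, EuclideanSpace.real_norm_sq_eq]
    refine Finset.sum_congr rfl fun k _ => ?_
    simp [harmonicTension, laplacianOfHessian, nD]
  have eA : eLpNorm Dd 4 volume ^ 4
      = ENNReal.ofReal (∫ x, (∑ i, ∑ k, Dd x i k ^ 2) ^ 2) := by
    have := eLpNorm_natCast_pow_eq_ofReal_integral (f := Dd) (m := 4) (by norm_num)
      (by simpa only [n4] using iA)
    simpa only [n4, Nat.cast_ofNat] using this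
  have eB : eLpNorm (laplacianOfHessian D2d) 2 volume ^ 2
      = ENNReal.ofReal (∫ x, ∑ k, (∑ i, D2d x i i k) ^ 2) := by
    have := eLpNorm_natCast_pow_eq_ofReal_integral (f := laplacianOfHessian D2d) (m := 2)
      (by norm_num) (by simpa only [nL] using iB)
    simpa only [nL, Nat.cast_ofNat] using this
  have eT : eLpNorm (harmonicTension d Dd D2d) 2 volume ^ 2
      = ENNReal.ofReal ((∫ x, ∑ k, (∑ i, D2d x i i k) ^ 2)
        - ∫ x, (∑ i, ∑ k, Dd x i k ^ 2) ^ 2) := by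
    have := eLpNorm_natCast_pow_eq_ofReal_integral (f := harmonicTension d Dd D2d) (m := 2)
      (by norm_num) ((iB.sub iA).congr (by filter_upwards [nT] with x hx using hx.symm))
    rw [← integral_sub iB iA, ← integral_congr_ae nT]
    exact this
  have hA0 : 0 ≤ ∫ x, (∑ i, ∑ k, Dd x i k ^ 2) ^ 2 := integral_nonneg fun x => sq_nonneg _
  have hB0 : 0 ≤ ∫ x, ∑ k, (∑ i, D2d x i i k) ^ 2 :=
    integral_nonneg fun x => Finset.sum_nonneg fun k _ => sq_nonneg _
  rw [eA, eB, eT]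
  set A := ∫ x, (∑ i, ∑ k, Dd x i k ^ 2) ^ 2
  set B := ∫ x, ∑ k, (∑ i, D2d x i i k) ^ 2
  have hmain' : A ≤ M * (B - A) := hmain
  have hδ : 1 / (1 + M) ≤ 1 := by
    rw [div_le_one (by positivity)]
    linarith
  have hAB : 1 / (1 + M) * B ≤ B - A := by
    rw [div_mul_eq_mul_div, div_le_iff₀ (by positivity)]
    linarith
  constructor
  · rw [← ENNReal.ofReal_mul (by linarith)]
    exact ENNReal.ofReal_le_ofReal (by linarith)
  · rw [← ENNReal.ofReal_add hB0 hA0, ← ENNReal.ofReal_mul (by positivity)]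
    refine ENNReal.ofReal_le_ofReal ?_
    have hle : A ≤ B := by nlinarith
    have h1 : 1 / (1 + M) * A ≤ 1 / (1 + M) * B := mul_le_mul_of_nonneg_left hle (by positivity)
    linarith
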